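/- Let $S^3=\{(x,y,z,w)\in\mathbb R^4: x^2+y^2+z^2+w^2=1\}$ be the round three-sphere, with the vector fields $$E_1=\tfrac12(w\partial_x-z\partial_y+y\partial_z-x\partial_w),\quad E_2=\tfrac12(z\partial_x+w\partial_y-x\partial_z-y\partial_w),\quad E_3=\tfrac12(-y\partial_x+x\partial_y+w\partial_z-z\partial_w),$$ and let $\pi:S^3\to S^2$ be the Hopf map onto the unit sphere $S^2\subset\mathbb R^3$ whose fibres are the orbits of the Hopf field $E_1$, $$\pi(x,y,z,w)=\bigl(w^2+x^2-y^2-z^2,\;2(xy-wz),\;2(xz+wy)\bigr),\qquad \pi^*f=f\circ\pi .$$ All functions and vector fields are smooth. Let $\mathfrak X_\mu(S^n)$ be the Lie algebra of divergence-free vector fields on the round unit sphere $S^n$, with the commutator of vector fields, and let $\mathfrak X^1_\mu(S^3)=\{u\in\mathfrak X_\mu(S^3):[E_1,u]=0\}$, which is a Lie subalgebra. On $S^2$ let $\{f,h\}$ be the Poisson bracket, $\{f,h\}\mu=df\wedge dh$ with $\mu$ the area form (outward orientation), and let $X_\psi(p)=p\times\nabla\psi(p)$ be the Hamiltonian vector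 field with stream function $\psi\in C^\infty(S^2)$. Then: 1. A vector field on $S^2$ is divergence-free if and only if it equals $X_\psi$ for some $\psi\in C^\infty(S^2)$. The Lie algebra $\mathfrak X_\mu(S^2)$ acts on $C^\infty(S^2)$ by derivatives along vector fields, and $\rho(X_\psi)\sigma=\{\psi,\sigma\}$. 2. The pullback $\pi^*$ is injective on $C^\infty(S^2)$, and its image is the set of $\tilde f\in C^\infty(S^3)$ with $E_1\tilde f=0$. 3. A vector field $u$ on $S^3$ belongs to $\mathfrak X^1_\mu(S^3)$ if and only if $$u=\tilde\sigma E_1-(E_3\tilde\psi)E_2+(E_2\tilde\psi)E_3\qquad\text{for some }\tilde\sigma,\tilde\psi\in C^\infty(S^3)\text{ with }E_1\tilde\sigma=E_1\tilde\psi=0. $$ 4. The formula $b(X_{\psi_1},X_{\psi_2})=-\{\psi_1,\psi_2\}$ defines a 2-cocycle on $\mathfrak X_\mu(S^2)$ with values in the module $C^\infty(S^2)$, and the Lie algebra $\mathfrak X^1_\mu(S^3)$ is isomorphic to the Abelian extension $\mathfrak X_\mu(S^2)\times C^\infty(S^2)$ with bracket $$[(v_1,\sigma_1),(v_2,\sigma_2)]=\bigl([v_1,v_2],\;\rho(v_1)\sigma_2-\rho(v_2)\sigma_1+b(v_1,v_2)\bigr).$$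 There is an isomorphism under which $u\in\mathfrak X^1_\mu(S^3)$ corresponds to $(X_\psi,\sigma)$ if and only if $u=(\pi^*\sigma)E_1-(E_3\pi^*\psi)E_2+(E_2\pi^*\psi)E_3$. -/

import Mathlib

open scoped Manifold ContDiff InnerProductSpace Gradient

noncomputable section

namespace SphereFlow

/-- Euclidean space `ℝⁿ⁺¹`. -/
abbrev Amb (n : ℕ) := EuclideanSpace ℝ (Fin (n + 1))

/-- The unit sphere `Sⁿ ⊂ ℝⁿ⁺¹`, with Mathlib's smooth structure. -/
abbrev Sph (n : ℕ) := Metric.sphere (0 : Amb n) 1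

/-- The algebra `C^∞(Sⁿ)` of smooth real functions. -/
abbrev SmoothFun (n : ℕ) := C^∞⟮𝓡 n, Sph n; ℝ⟯

/-- The extension `y ↦ f (y / |y|)` of a map on `Sⁿ` to `ℝⁿ⁺¹ ∖ {0}` (with value `0` at `0`).
It is constant along rays, so for `p ∈ Sⁿ` and `v ⟂ p` the number `fderiv ℝ (radialExt f) p v` is
the intrinsic derivative of `f` at `p` in the direction `v`, and the radial derivative is zero. -/
def radialExt {n : ℕ} {F : Type*} [NormedAddCommGroup F] (f : Sph n → F) (y : Amb n) : F :=
  if h : y = 0 then 0 else f ⟨‖y‖⁻¹ • y, by simp [norm_smul, h]⟩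

section basic

theorem two_le_smooth : (2 : WithTop ℕ∞) ≤ ∞ :=
  WithTop.coe_le_coe.2 (le_top : (2 : ℕ∞) ≤ ⊤)

theorem coe_ne_zero {n : ℕ} (p : Sph n) : (p : Amb n) ≠ 0 := by
  intro h
  have hp : ‖(p : Amb n)‖ = 1 := by simp
  simp [h] at hp

theorem radialExt_coe {n : ℕ} {F : Type*} [NormedAddCommGroup F] (f : Sph n → F) (p : Sph n) :
    radialExt f (p : Amb n) = f p := by
  have hp : ‖(p : Amb n)‖ = 1 := by simp
  simp only [radialExt, coe_ne_zero p, dite_false]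
  congr 1
  ext1
  simp [hp]

theorem exists_radial {n : ℕ} (F : Type*) [NormedAddCommGroup F] {y : Amb n} (hy : y ≠ 0) :
    ∃ p : Sph n, (p : Amb n) = ‖y‖⁻¹ • y ∧ ∀ f : Sph n → F, radialExt f y = f p :=
  ⟨⟨‖y‖⁻¹ • y, by simp [norm_smul, hy]⟩, rfl, fun f => by simp [radialExt, hy]⟩

theorem radialExt_smul {n : ℕ} {F : Type*} [NormedAddCommGroup F] (f : Sph n → F) {c : ℝ}
    (hc : 0 < c) (y : Amb n) : radialExt f (c • y) = radialExt f y := by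
  by_cases hy : y = 0
  · simp [hy]
  · have : c • y ≠ 0 := smul_ne_zero hc.ne' hy
    simp only [radialExt, hy, this, dite_false]
    congr 2
    rw [norm_smul, Real.norm_of_nonneg hc.le, smul_smul]
    congr 1
    field_simp

variable {n : ℕ} {F : Type*} [NormedAddCommGroup F] [NormedSpace ℝ F]

theorem contDiffAt_radialExt {f : Sph n → F} (hf : ContMDiff (𝓡 n) 𝓘(ℝ, F) ∞ f) {y : Amb n}
    (hy : y ≠ 0) : ContDiffAt ℝ ∞ (radialExt f) y := by
  have := Fact.mk (@finrank_euclideanSpace_fin ℝ _ (n + 1))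
  let U : TopologicalSpace.Opens (Amb n) := ⟨{0}ᶜ, isOpen_compl_singleton⟩
  have h1 : ContMDiff 𝓘(ℝ, Amb n) 𝓘(ℝ, Amb n) ∞ (fun x : U => ‖(x : Amb n)‖⁻¹ • (x : Amb n)) := by
    intro x
    have hx : (x : Amb n) ≠ 0 := x.2
    refine (contMDiffAt_subtype_iff (U := U) (f := fun x : Amb n => ‖x‖⁻¹ • x)).2 ?_
    exact (((contDiffAt_norm ℝ hx).inv (by simpa using hx)).smul contDiffAt_id).contMDiffAt
  have h2 := hf.comp (h1.codRestrict_sphere (n := n) (fun x => by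
    have hx : (x : Amb n) ≠ 0 := x.2
    simp [norm_smul, hx]))
  have h3 : ContMDiffAt 𝓘(ℝ, Amb n) 𝓘(ℝ, F) ∞ (fun x : U => radialExt f (x : Amb n)) ⟨y, hy⟩ := by
    refine (h2 ⟨y, hy⟩).congr_of_eventuallyEq (Filter.Eventually.of_forall fun x => ?_)
    have hx : (x : Amb n) ≠ 0 := x.2
    simp [radialExt, hx]
    rfl
  exact (contMDiffAt_subtype_iff.1 h3).contDiffAt

theorem contMDiff_restrict {g : Amb n → F} (hg : ∀ y, y ≠ 0 → ContDiffAt ℝ ∞ g y) :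
    ContMDiff (𝓡 n) 𝓘(ℝ, F) ∞ (fun p : Sph n => g p) := fun p =>
  have := Fact.mk (@finrank_euclideanSpace_fin ℝ _ (n + 1))
  ((hg p (coe_ne_zero p)).contMDiffAt).comp p (contMDiff_coe_sphere p)

theorem fderiv_radialExt_smul (f : Sph n → F) {c : ℝ} (hc : 0 < c) (y : Amb n) :
    fderiv ℝ (radialExt f) (c • y) = c⁻¹ • fderiv ℝ (radialExt f) y := by
  have h : (fun x => radialExt f (c • x)) = radialExt f := by
    ext x; exact radialExt_smul f hc x
  have h2 := fderiv_comp_smul (𝕜 := ℝ) (f := radialExt f) (c := c) (x := y)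
  rw [h] at h2
  rw [h2, smul_smul, inv_mul_cancel₀ hc.ne', one_smul]

theorem fderiv_eq_of_norm_smul (p : Sph n) {g h : Amb n → F} (hg : DifferentiableAt ℝ g p)
    (hh : ∀ y, y ≠ 0 → h y = ‖y‖ • g y) (v : Amb n) :
    fderiv ℝ h p v = fderiv ℝ g p v + ⟪(p : Amb n), v⟫_ℝ • g p := by
  have hp : ‖(p : Amb n)‖ = 1 := by simp
  have h0 := coe_ne_zero p
  have e : h =ᶠ[nhds (p : Amb n)] fun y => ‖y‖ • g y := by
    filter_upwards [isOpen_ne.mem_nhds h0] with y hy using hh y hy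
  have hn : DifferentiableAt ℝ (fun y : Amb n => ‖y‖) p :=
    (contDiffAt_norm (n := 1) ℝ h0).differentiableAt (by simp)
  have hd : fderiv ℝ (fun y : Amb n => ‖y‖) p v = ⟪(p : Amb n), v⟫_ℝ := by
    have h1 := (hasStrictFDerivAt_norm_sq (p : Amb n)).hasFDerivAt
    have h2 := (hn.hasFDerivAt.pow 2).unique h1
    have := DFunLike.congr_fun h2 v
    simp at this
    exact this
  rw [e.fderiv_eq, fderiv_fun_smul hn hg]
  simp [hd]

end basic

/-- Smooth tangent vector fields on `Sⁿ`, as smooth maps `X : Sⁿ → ℝⁿ⁺¹` with `X p ⟂ p`. -/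
def tangentFields (n : ℕ) : Submodule ℝ C^∞⟮𝓡 n, Sph n; 𝓘(ℝ, Amb n), Amb n⟯ where
  carrier := {X | ∀ p, ⟪X p, (p : Amb n)⟫_ℝ = 0}
  zero_mem' p := by simp
  add_mem' {X Y} hX hY p := by
    simp only [ContMDiffMap.coe_add, Pi.add_apply, inner_add_left]
    rw [hX p, hY p, add_zero]
  smul_mem' c X hX p := by
    simp only [ContMDiffMap.coe_smul, Pi.smul_apply, inner_smul_left]
    rw [hX p, mul_zero]

/-- The space `𝔛(Sⁿ)` of smooth vector fields on the sphere. -/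
abbrev VF (n : ℕ) := ↥(tangentFields n)

namespace VF

variable {n : ℕ}

/-- The radial extension of a vector field. -/
abbrev ext0 (X : VF n) : Amb n → Amb n := radialExt X.1

theorem smooth (X : VF n) {y : Amb n} (hy : y ≠ 0) : ContDiffAt ℝ ∞ X.ext0 y :=
  contDiffAt_radialExt X.1.contMDiff hy

theorem diff (X : VF n) {y : Amb n} (hy : y ≠ 0) : DifferentiableAt ℝ X.ext0 y :=
  (X.smooth hy).differentiableAt (by simp)

theorem inner_ext (X : VF n) (y : Amb n) : ⟪X.ext0 y, y⟫_ℝ = 0 := by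
  by_cases hy : y = 0
  · simp [hy]
  · obtain ⟨p, hp, h⟩ := exists_radial (Amb n) hy
    have := X.2 p
    rw [hp, inner_smul_right] at this
    rw [ext0, h]
    simpa [hy] using this

theorem inner_fderiv (X : VF n) (p : Sph n) (v : Amb n) :
    ⟪fderiv ℝ X.ext0 p v, (p : Amb n)⟫_ℝ = - ⟪X.ext0 p, v⟫_ℝ := by
  have h : fderiv ℝ (fun y => ⟪X.ext0 y, y⟫_ℝ) p v = 0 := by
    have : (fun y => ⟪X.ext0 y, y⟫_ℝ) = fun _ => 0 := by ext y; exact X.inner_ext y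
    rw [this]; simp
  rw [fderiv_inner_apply ℝ (X.diff (coe_ne_zero p)) differentiableAt_fun_id] at h
  simp at h
  linarith

theorem smooth_lieBracket (X Y : VF n) {y : Amb n} (hy : y ≠ 0) :
    ContDiffAt ℝ ∞ (VectorField.lieBracket ℝ X.ext0 Y.ext0) y :=
  (X.smooth hy).lieBracket_vectorField (Y.smooth hy) (m := ∞) (by simp)

/-- The Lie bracket `[X, Y] = D_X Y - D_Y X` of vector fields on the sphere. -/
def bracket (X Y : VF n) : VF n :=
  ⟨⟨fun p => VectorField.lieBracket ℝ X.ext0 Y.ext0 p,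
    contMDiff_restrict fun _ hy => smooth_lieBracket X Y hy⟩, fun p => by
      change ⟪VectorField.lieBracket ℝ X.ext0 Y.ext0 p, (p : Amb n)⟫_ℝ = 0
      rw [VectorField.lieBracket, inner_sub_left, inner_fderiv, inner_fderiv, real_inner_comm]
      ring⟩

theorem bracket_apply (X Y : VF n) (p : Sph n) :
    (bracket X Y).1 p = VectorField.lieBracket ℝ X.ext0 Y.ext0 p := rfl

theorem ext0_bracket (X Y : VF n) {y : Amb n} (hy : y ≠ 0) :
    (bracket X Y).ext0 y = ‖y‖ • VectorField.lieBracket ℝ X.ext0 Y.ext0 y := by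
  obtain ⟨p, hp, h⟩ := exists_radial (Amb n) hy
  have hc : 0 < ‖y‖⁻¹ := by positivity
  rw [ext0, h, bracket_apply, hp, VectorField.lieBracket, VectorField.lieBracket]
  simp only [ext0]
  rw [radialExt_smul _ hc, radialExt_smul _ hc, fderiv_radialExt_smul _ hc,
    fderiv_radialExt_smul _ hc]
  simp [smul_sub]

theorem ext0_add (X Y : VF n) : (X + Y).ext0 = X.ext0 + Y.ext0 := by
  ext1 y; by_cases hy : y = 0 <;> simp [radialExt, hy]

theorem ext0_smul (c : ℝ) (X : VF n) : (c • X).ext0 = c • X.ext0 := by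
  ext1 y; by_cases hy : y = 0 <;> simp [radialExt, hy]

theorem fderiv_ext0_bracket (X Y : VF n) (p : Sph n) (v : Amb n) :
    fderiv ℝ (bracket X Y).ext0 p v
      = fderiv ℝ (VectorField.lieBracket ℝ X.ext0 Y.ext0) p v
        + ⟪(p : Amb n), v⟫_ℝ • (bracket X Y).1 p :=
  fderiv_eq_of_norm_smul p ((smooth_lieBracket X Y (coe_ne_zero p)).differentiableAt (by simp))
    (fun _ hy => ext0_bracket X Y hy) v

theorem bracket_bracket (X Y Z : VF n) (p : Sph n) :
    (bracket X (bracket Y Z)).1 p = VectorField.lieBracket ℝ X.ext0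
      (VectorField.lieBracket ℝ Y.ext0 Z.ext0) p := by
  rw [bracket_apply, VectorField.lieBracket, VectorField.lieBracket]
  have e : (bracket Y Z).ext0 p = VectorField.lieBracket ℝ Y.ext0 Z.ext0 p := by
    rw [ext0, radialExt_coe, bracket_apply]
  rw [e, fderiv_ext0_bracket, real_inner_comm, X.inner_ext p]
  simp

theorem vf_ext {X Y : VF n} (h : ∀ p, X.1 p = Y.1 p) : X = Y :=
  Subtype.ext (ContMDiffMap.ext h)

instance : LieRing (VF n) where
  bracket := bracket
  add_lie X Y Z := vf_ext fun p => by
    change VectorField.lieBracket ℝ (X + Y).ext0 Z.ext0 p =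
      VectorField.lieBracket ℝ X.ext0 Z.ext0 p + VectorField.lieBracket ℝ Y.ext0 Z.ext0 p
    rw [ext0_add, VectorField.lieBracket_add_left (X.diff (coe_ne_zero p)) (Y.diff (coe_ne_zero p))]
  lie_add X Y Z := vf_ext fun p => by
    change VectorField.lieBracket ℝ X.ext0 (Y + Z).ext0 p =
      VectorField.lieBracket ℝ X.ext0 Y.ext0 p + VectorField.lieBracket ℝ X.ext0 Z.ext0 p
    rw [ext0_add, VectorField.lieBracket_add_right (Y.diff (coe_ne_zero p)) (Z.diff (coe_ne_zero p))]
  lie_self X := vf_ext fun p => by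
    change VectorField.lieBracket ℝ X.ext0 X.ext0 p = 0
    simp
  leibniz_lie X Y Z := vf_ext fun p => by
    change (bracket X (bracket Y Z)).1 p =
      (bracket (bracket X Y) Z).1 p + (bracket Y (bracket X Z)).1 p
    have e : (bracket (bracket X Y) Z).1 p = - (bracket Z (bracket X Y)).1 p := by
      rw [bracket_apply, bracket_apply, VectorField.lieBracket_swap]
    rw [e, bracket_bracket, bracket_bracket, bracket_bracket]
    have h0 := coe_ne_zero p
    have key := VectorField.leibniz_identity_lieBracket (𝕜 := ℝ) (n := 2) (by simp)
      ((X.smooth h0).of_le two_le_smooth)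
      ((Y.smooth h0).of_le two_le_smooth)
      ((Z.smooth h0).of_le two_le_smooth)
    rw [key, VectorField.lieBracket_swap (V := Z.ext0), neg_neg]

instance : LieAlgebra ℝ (VF n) where
  lie_smul c X Y := vf_ext fun p => by
    change VectorField.lieBracket ℝ X.ext0 (c • Y).ext0 p =
      c • VectorField.lieBracket ℝ X.ext0 Y.ext0 p
    rw [ext0_smul, VectorField.lieBracket_const_smul_right (Y.diff (coe_ne_zero p))]

theorem lie_apply (X Y : VF n) (p : Sph n) :
    (⁅X, Y⁆ : VF n).1 p = VectorField.lieBracket ℝ X.ext0 Y.ext0 p := rfl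

theorem smooth_fun (f : SmoothFun n) {y : Amb n} (hy : y ≠ 0) :
    ContDiffAt ℝ ∞ (radialExt f) y :=
  contDiffAt_radialExt f.contMDiff hy

theorem smooth_deriv (X : VF n) (f : SmoothFun n) {y : Amb n} (hy : y ≠ 0) :
    ContDiffAt ℝ ∞ (fun y => fderiv ℝ (radialExt f) y (X.ext0 y)) y :=
  ((smooth_fun f hy).fderiv_right (m := ∞) (by simp)).clm_apply (X.smooth hy)

/-- The derivative `X f` of a function along a vector field, `(X f)(p) = df_p (X p)`. -/
def deriv (X : VF n) (f : SmoothFun n) : SmoothFun n :=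
  ⟨fun p => fderiv ℝ (radialExt f) p (X.ext0 p), contMDiff_restrict fun _ hy => smooth_deriv X f hy⟩

theorem deriv_apply (X : VF n) (f : SmoothFun n) (p : Sph n) :
    X.deriv f p = fderiv ℝ (radialExt f) p (X.ext0 p) := rfl

theorem radialExt_deriv (X : VF n) (f : SmoothFun n) {y : Amb n} (hy : y ≠ 0) :
    radialExt (X.deriv f) y = ‖y‖ • fderiv ℝ (radialExt f) y (X.ext0 y) := by
  obtain ⟨p, hp, h⟩ := exists_radial ℝ hy
  have hc : 0 < ‖y‖⁻¹ := by positivity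
  rw [h, deriv_apply, hp]
  simp only [ext0]
  rw [radialExt_smul _ hc, fderiv_radialExt_smul _ hc]
  simp

theorem deriv_deriv (X Y : VF n) (f : SmoothFun n) (p : Sph n) :
    X.deriv (Y.deriv f) p =
      fderiv ℝ (fun y => fderiv ℝ (radialExt f) y (Y.ext0 y)) p (X.ext0 p) := by
  rw [deriv_apply, fderiv_eq_of_norm_smul p
    ((smooth_deriv Y f (coe_ne_zero p)).differentiableAt (by simp))
    (fun y hy => radialExt_deriv Y f hy), real_inner_comm, X.inner_ext p]
  simp

/-- `C^∞(Sⁿ)` as a module over the Lie algebra of vector fields, `⁅X, f⁆ = X f`. -/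
instance : LieRingModule (VF n) (SmoothFun n) where
  bracket := deriv
  add_lie X Y f := ContMDiffMap.ext fun p => by
    change fderiv ℝ (radialExt f) p ((X + Y).ext0 p) =
      fderiv ℝ (radialExt f) p (X.ext0 p) + fderiv ℝ (radialExt f) p (Y.ext0 p)
    rw [ext0_add]; simp
  lie_add X f g := ContMDiffMap.ext fun p => by
    change fderiv ℝ (radialExt (f + g)) p (X.ext0 p) =
      fderiv ℝ (radialExt f) p (X.ext0 p) + fderiv ℝ (radialExt g) p (X.ext0 p)
    have e : radialExt (f + g) = radialExt f + radialExt g := by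
      ext1 y; by_cases hy : y = 0 <;> simp [radialExt, hy]
    rw [e, fderiv_add ((smooth_fun f (coe_ne_zero p)).differentiableAt (by simp))
      ((smooth_fun g (coe_ne_zero p)).differentiableAt (by simp))]
    simp
  leibniz_lie X Y f := ContMDiffMap.ext fun p => by
    change X.deriv (Y.deriv f) p = (bracket X Y).deriv f p + Y.deriv (X.deriv f) p
    have h0 := coe_ne_zero p
    have e : (bracket X Y).ext0 p = VectorField.lieBracket ℝ X.ext0 Y.ext0 p := by
      rw [ext0, radialExt_coe, bracket_apply]
    rw [deriv_deriv, deriv_deriv, deriv_apply, e,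
      VectorField.fderiv_apply_lieBracket (n := 2)
        ((smooth_fun f h0).of_le two_le_smooth) (by simp) (Y.diff h0) (X.diff h0)]
    ring

instance : LieModule ℝ (VF n) (SmoothFun n) where
  smul_lie c X f := ContMDiffMap.ext fun p => by
    change fderiv ℝ (radialExt f) p ((c • X).ext0 p) = c • fderiv ℝ (radialExt f) p (X.ext0 p)
    rw [ext0_smul]; simp
  lie_smul c X f := ContMDiffMap.ext fun p => by
    change fderiv ℝ (radialExt (c • f)) p (X.ext0 p) = c • fderiv ℝ (radialExt f) p (X.ext0 p)
    have e : radialExt (c • f) = c • radialExt f := by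
      ext1 y; by_cases hy : y = 0 <;> simp [radialExt, hy]
    rw [e, fderiv_const_smul ((smooth_fun f (coe_ne_zero p)).differentiableAt (by simp))]
    simp

theorem lie_fun_apply (X : VF n) (f : SmoothFun n) (p : Sph n) :
    ⁅X, f⁆ p = fderiv ℝ (radialExt f) p (X.ext0 p) := rfl

/-- The divergence of a vector field on the round sphere: `(div X)(p) = ∑ ⟪D_{eᵢ} X, eᵢ⟫` over an
orthonormal basis `(eᵢ)` of the tangent space `p^⊥`. The radial direction does not
contribute, since the extension of `X` is constant along rays. -/
def div (X : VF n) (p : Sph n) : ℝ :=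
  LinearMap.trace ℝ (Amb n) (fderiv ℝ X.ext0 p : Amb n →ₗ[ℝ] Amb n)

/-- The trace as a continuous linear functional on the endomorphisms of `ℝⁿ⁺¹`. -/
def traceL (n : ℕ) : (Amb n →L[ℝ] Amb n) →L[ℝ] ℝ :=
  LinearMap.toContinuousLinearMap
    ((LinearMap.trace ℝ (Amb n)).comp (ContinuousLinearMap.coeLM ℝ))

theorem traceL_apply (A : Amb n →L[ℝ] Amb n) :
    traceL n A = LinearMap.trace ℝ (Amb n) (A : Amb n →ₗ[ℝ] Amb n) := rfl

theorem div_eq_traceL (X : VF n) (p : Sph n) : X.div p = traceL n (fderiv ℝ X.ext0 p) := rfl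

theorem trace_fderiv_eq_zero {X : VF n} (hX : ∀ p, X.div p = 0) {y : Amb n} (hy : y ≠ 0) :
    traceL n (fderiv ℝ X.ext0 y) = 0 := by
  obtain ⟨p, hp, -⟩ := exists_radial (Amb n) hy
  have h := hX p
  rw [div_eq_traceL, hp, fderiv_radialExt_smul _ (by positivity), map_smul] at h
  simpa [hy] using h

theorem trace_snd_eq_zero {X : VF n} (hX : ∀ p, X.div p = 0) (p : Sph n) (w : Amb n) :
    traceL n (fderiv ℝ (fderiv ℝ X.ext0) p w) = 0 := by
  have h0 := coe_ne_zero p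
  have hd : DifferentiableAt ℝ (fderiv ℝ X.ext0) p :=
    ((X.smooth h0).fderiv_right (m := 1) (by simpa [one_add_one_eq_two] using two_le_smooth)).differentiableAt (by simp)
  have h1 := ((traceL n).hasFDerivAt.comp (p : Amb n) hd.hasFDerivAt).fderiv
  have h2 : (traceL n ∘ fderiv ℝ X.ext0) =ᶠ[nhds (p : Amb n)] fun _ => 0 := by
    filter_upwards [isOpen_ne.mem_nhds h0] with y hy using trace_fderiv_eq_zero hX hy
  rw [h2.fderiv_eq] at h1
  have := DFunLike.congr_fun h1 w
  simpa using this.symm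

theorem fderiv_lieBracket_apply (X Y : VF n) (p : Sph n) (v : Amb n) :
    fderiv ℝ (VectorField.lieBracket ℝ X.ext0 Y.ext0) p v =
      (fderiv ℝ (fderiv ℝ Y.ext0) p (X.ext0 p) v + fderiv ℝ Y.ext0 p (fderiv ℝ X.ext0 p v)) -
      (fderiv ℝ (fderiv ℝ X.ext0) p (Y.ext0 p) v + fderiv ℝ X.ext0 p (fderiv ℝ Y.ext0 p v)) := by
  have h0 := coe_ne_zero p
  have hX : DifferentiableAt ℝ (fderiv ℝ X.ext0) p :=
    ((X.smooth h0).fderiv_right (m := 1) (by simpa [one_add_one_eq_two] using two_le_smooth)).differentiableAt (by simp)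
  have hY : DifferentiableAt ℝ (fderiv ℝ Y.ext0) p :=
    ((Y.smooth h0).fderiv_right (m := 1) (by simpa [one_add_one_eq_two] using two_le_smooth)).differentiableAt (by simp)
  have sX : IsSymmSndFDerivAt ℝ X.ext0 p := (X.smooth h0).isSymmSndFDerivAt (by simpa using two_le_smooth)
  have sY : IsSymmSndFDerivAt ℝ Y.ext0 p := (Y.smooth h0).isSymmSndFDerivAt (by simpa using two_le_smooth)
  have e : VectorField.lieBracket ℝ X.ext0 Y.ext0 =
      fun y => fderiv ℝ Y.ext0 y (X.ext0 y) - fderiv ℝ X.ext0 y (Y.ext0 y) := rfl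
  rw [e, fderiv_fun_sub (hY.clm_apply (X.diff h0)) (hX.clm_apply (Y.diff h0)),
    fderiv_clm_apply hY (X.diff h0), fderiv_clm_apply hX (Y.diff h0)]
  simp [sY.eq v, sX.eq v]
  abel

theorem div_lie {X Y : VF n} (hX : ∀ p, X.div p = 0) (hY : ∀ p, Y.div p = 0) (p : Sph n) :
    (⁅X, Y⁆ : VF n).div p = 0 := by
  set A := fderiv ℝ X.ext0 p
  set B := fderiv ℝ Y.ext0 p
  have e : fderiv ℝ (bracket X Y).ext0 p =
      (fderiv ℝ (fderiv ℝ Y.ext0) p (X.ext0 p) + B.comp A) -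
      (fderiv ℝ (fderiv ℝ X.ext0) p (Y.ext0 p) + A.comp B) +
      (innerSL ℝ (p : Amb n)).smulRight ((bracket X Y).1 p) := by
    ext1 v
    rw [fderiv_ext0_bracket, fderiv_lieBracket_apply]
    simp [A, B]
  change (bracket X Y).div p = 0
  have hc : traceL n (B.comp A) = traceL n (A.comp B) := by
    rw [traceL_apply, traceL_apply]
    exact LinearMap.trace_mul_comm ℝ (B : Amb n →ₗ[ℝ] Amb n) (A : Amb n →ₗ[ℝ] Amb n)
  have hr : traceL n ((innerSL ℝ (p : Amb n)).smulRight ((bracket X Y).1 p)) = 0 := by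
    rw [traceL_apply]
    have := LinearMap.trace_smulRight ((innerSL ℝ (p : Amb n)) : Amb n →ₗ[ℝ] ℝ)
      ((bracket X Y).1 p)
    refine this.trans ?_
    simp only [ContinuousLinearMap.coe_coe, innerSL_apply_apply]
    rw [real_inner_comm]
    exact (bracket X Y).2 p
  rw [div_eq_traceL, e, map_add, map_sub, map_add, map_add, trace_snd_eq_zero hX,
    trace_snd_eq_zero hY, hc, hr]
  ring

theorem div_add (X Y : VF n) (p : Sph n) : (X + Y).div p = X.div p + Y.div p := by
  have h0 := coe_ne_zero p
  rw [div_eq_traceL, ext0_add, fderiv_add (X.diff h0) (Y.diff h0), map_add]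
  rfl

theorem div_smul (c : ℝ) (X : VF n) (p : Sph n) : (c • X).div p = c * X.div p := by
  have h0 := coe_ne_zero p
  rw [div_eq_traceL, ext0_smul, fderiv_const_smul (X.diff h0), map_smul]
  rfl

end VF

/-- The Lie algebra `𝔛_μ(Sⁿ)` of divergence-free vector fields on `Sⁿ`. -/
def divFree (n : ℕ) : LieSubalgebra ℝ (VF n) where
  carrier := {X | ∀ p, X.div p = 0}
  zero_mem' p := by
    have := VF.div_smul (0 : ℝ) (0 : VF n) p
    simpa using this
  add_mem' hX hY p := by rw [VF.div_add, hX p, hY p, add_zero]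
  smul_mem' c X hX p := by rw [VF.div_smul, hX p, mul_zero]
  lie_mem' hX hY := VF.div_lie hX hY

/-- The vector field `p ↦ A p` on `S³` given by a linear map `A` with `A y ⟂ y`. -/
def linearField (A : Amb 3 →ₗ[ℝ] Amb 3) (hA : ∀ y, ⟪A y, y⟫_ℝ = 0) : VF 3 :=
  ⟨⟨fun p => A p, contMDiff_restrict fun _ _ => A.toContinuousLinearMap.contDiff.contDiffAt⟩,
    fun p => hA p⟩

/-- The matrix of `E₁ = ½ (w ∂_x - z ∂_y + y ∂_z - x ∂_w)` in the coordinates `(x, y, z, w)`. -/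
def matE1 : Matrix (Fin 4) (Fin 4) ℝ :=
  (1 / 2 : ℝ) • !![0, 0, 0, 1; 0, 0, -1, 0; 0, 1, 0, 0; -1, 0, 0, 0]

/-- The matrix of `E₂ = ½ (z ∂_x + w ∂_y - x ∂_z - y ∂_w)` in the coordinates `(x, y, z, w)`. -/
def matE2 : Matrix (Fin 4) (Fin 4) ℝ :=
  (1 / 2 : ℝ) • !![0, 0, 1, 0; 0, 0, 0, 1; -1, 0, 0, 0; 0, -1, 0, 0]

/-- The matrix of `E₃ = ½ (-y ∂_x + x ∂_y + w ∂_z - z ∂_w)` in the coordinates `(x, y, z, w)`. -/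
def matE3 : Matrix (Fin 4) (Fin 4) ℝ :=
  (1 / 2 : ℝ) • !![0, -1, 0, 0; 1, 0, 0, 0; 0, 0, 0, 1; 0, 0, -1, 0]

/-- The Hopf field `E₁` on `S³`. -/
def E1 : VF 3 := linearField (Matrix.toEuclideanLin matE1) fun y => by
  simp [matE1, PiLp.inner_apply, Fin.sum_univ_four, Matrix.toLpLin_apply, dotProduct]
  ring

/-- The field `E₂` on `S³`. -/
def E2 : VF 3 := linearField (Matrix.toEuclideanLin matE2) fun y => by
  simp [matE2, PiLp.inner_apply, Fin.sum_univ_four, Matrix.toLpLin_apply, dotProduct]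
  ring

/-- The field `E₃` on `S³`. -/
def E3 : VF 3 := linearField (Matrix.toEuclideanLin matE3) fun y => by
  simp [matE3, PiLp.inner_apply, Fin.sum_univ_four, Matrix.toLpLin_apply, dotProduct]
  ring

/-- The Lie algebra `𝔛¹_μ(S³)` of divergence-free vector fields `u` on `S³` that are
`E₁`-invariant, `[E₁, u] = 0`. -/
def hopfDivFree : LieSubalgebra ℝ (VF 3) where
  carrier := {u | u ∈ divFree 3 ∧ ⁅E1, u⁆ = 0}
  zero_mem' := ⟨(divFree 3).zero_mem, lie_zero _⟩
  add_mem' hX hY := ⟨(divFree 3).add_mem hX.1 hY.1, by rw [lie_add, hX.2, hY.2, add_zero]⟩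
  smul_mem' c X hX := ⟨(divFree 3).smul_mem c hX.1, by rw [lie_smul, hX.2, smul_zero]⟩
  lie_mem' hX hY := ⟨(divFree 3).lie_mem hX.1 hY.1, by
    rw [leibniz_lie, hX.2, hY.2, zero_lie, lie_zero, add_zero]⟩

/-- The Hopf map `ℝ⁴ → ℝ³`; for `q = w + xi + yj + zk` it is `q ↦ q̄ i q`. -/
def hopfAmb (q : Amb 3) : Amb 2 :=
  !₂[q 3 ^ 2 + q 0 ^ 2 - q 1 ^ 2 - q 2 ^ 2,
     2 * (q 0 * q 1 - q 3 * q 2),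
     2 * (q 0 * q 2 + q 3 * q 1)]

theorem hopfAmb_mem (p : Sph 3) : hopfAmb p ∈ Sph 2 := by
  have hp : ‖(p : Amb 3)‖ = 1 := by simp
  have h2 : ‖(p : Amb 3)‖ ^ 2 = 1 := by rw [hp]; norm_num
  rw [EuclideanSpace.norm_sq_eq, Fin.sum_univ_four] at h2
  simp only [Real.norm_eq_abs, sq_abs] at h2
  rw [mem_sphere_zero_iff_norm, ← sq_eq_sq₀ (norm_nonneg _) zero_le_one,
    EuclideanSpace.norm_sq_eq, Fin.sum_univ_three]
  simp only [Real.norm_eq_abs, sq_abs, hopfAmb]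
  simp
  linear_combination (((p : Amb 3) 0) ^ 2 + ((p : Amb 3) 1) ^ 2 + ((p : Amb 3) 2) ^ 2
    + ((p : Amb 3) 3) ^ 2 + 1) * h2

/-- The Hopf map `π : S³ → S²`, whose fibres are the orbits of the flow of `E₁`. -/
def hopf : C^∞⟮𝓡 3, Sph 3; 𝓡 2, Sph 2⟯ :=
  ⟨Set.codRestrict (fun p : Sph 3 => hopfAmb p) (Sph 2) hopfAmb_mem, by
    have := Fact.mk (@finrank_euclideanSpace_fin ℝ _ (2 + 1))
    refine ContMDiff.codRestrict_sphere (n := 2) (contMDiff_restrict fun y _ => ?_) _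
    refine ContDiff.contDiffAt ?_
    rw [contDiff_euclidean]
    intro i
    fin_cases i <;> simp [hopfAmb] <;> fun_prop⟩

/-- The pullback `π^* f = f ∘ π` of a function along the Hopf map. -/
def hopfPullback (f : SmoothFun 2) : SmoothFun 3 := f.comp hopf

/-- The cross product on Euclidean three-space. -/
def cross (a b : Amb 2) : Amb 2 := WithLp.toLp 2 (crossProduct a.ofLp b.ofLp)

/-- The gradient on `S²` of a function. -/
def sgrad (f : SmoothFun 2) (p : Sph 2) : Amb 2 := ∇ (radialExt f) p

theorem smooth_gradient (f : SmoothFun 2) {y : Amb 2} (hy : y ≠ 0) :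
    ContDiffAt ℝ ∞ (∇ (radialExt f)) y :=
  (InnerProductSpace.toDual ℝ (Amb 2)).symm.contDiff.contDiffAt.comp y
    ((VF.smooth_fun f hy).fderiv_right (m := ∞) (by simp))

theorem contDiff_coord (i : Fin 3) : ContDiff ℝ ∞ (fun a : Amb 2 => a i) := by fun_prop

theorem smooth_cross {f g : Amb 2 → Amb 2} {y : Amb 2} (hf : ContDiffAt ℝ ∞ f y)
    (hg : ContDiffAt ℝ ∞ g y) : ContDiffAt ℝ ∞ (fun y => cross (f y) (g y)) y := by
  have hf' : ∀ i, ContDiffAt ℝ ∞ (fun y => f y i) y := fun i =>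
    (contDiff_coord i).contDiffAt.comp y hf
  have hg' : ∀ i, ContDiffAt ℝ ∞ (fun y => g y i) y := fun i =>
    (contDiff_coord i).contDiffAt.comp y hg
  rw [contDiffAt_euclidean]
  intro i
  fin_cases i <;> simp [cross, cross_apply]
  · exact ((hf' 1).mul (hg' 2)).sub ((hf' 2).mul (hg' 1))
  · exact ((hf' 2).mul (hg' 0)).sub ((hf' 0).mul (hg' 2))
  · exact ((hf' 0).mul (hg' 1)).sub ((hf' 1).mul (hg' 0))

/-- The Poisson bracket on `S²`, `{f, h} μ = df ∧ dh` with `μ` the area form of the unit sphere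
oriented by the outward normal: `{f, h}(p) = p · (∇f × ∇h)`. -/
def poisson (f h : SmoothFun 2) : SmoothFun 2 :=
  ⟨fun p => ⟪(p : Amb 2), cross (sgrad f p) (sgrad h p)⟫_ℝ, contMDiff_restrict
    (g := fun y => ⟪y, cross (∇ (radialExt f) y) (∇ (radialExt h) y)⟫_ℝ) fun _ hy =>
      contDiffAt_id.inner ℝ (smooth_cross (smooth_gradient f hy) (smooth_gradient h hy))⟩

/-- The Hamiltonian vector field `X_ψ` on `S²` with stream function `ψ`: `X_ψ(p) = p × ∇ψ(p)`. -/
def hamField (ψ : SmoothFun 2) : VF 2 :=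
  ⟨⟨fun p => cross p (sgrad ψ p), contMDiff_restrict (g := fun y => cross y (∇ (radialExt ψ) y))
    fun _ hy => smooth_cross contDiffAt_id (smooth_gradient ψ hy)⟩, fun p => by
      change ⟪cross p (sgrad ψ p), (p : Amb 2)⟫_ℝ = 0
      simp [cross, cross_apply, PiLp.inner_apply, Fin.sum_univ_three]
      ring⟩

/-- The vector field `u` on `S³` has the form `u = σ E₁ - (E₃ ψ) E₂ + (E₂ ψ) E₃`. -/
def HasForm (u : VF 3) (σ ψ : SmoothFun 3) : Prop :=
  ∀ p, u.1 p = σ p • E1.1 p - ⁅E3, ψ⁆ p • E2.1 p + ⁅E2, ψ⁆ p • E3.1 p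

end SphereFlow

end

open SphereFlow

/-! The fields `E1`, `E2`, `E3` form an orthogonal frame of `S³`, divergence-free, with `[E1,E2] =
-E3`, `[E1,E3] = E2`, `[E2,E3] = -E1`. For `u = c₁E₁ + c₂E₂ + c₃E₃` the condition `[E1,u] = 0` reads
`E₁c₁ = 0`, `E₁c₂ = -c₃`, `E₁c₃ = c₂`, and the divergence then vanishes iff `E₂c₂ + E₃c₃ = 0`. The
last three equations say that the one-form with values `0`, `c₃`, `-c₂` on `E1`, `E2`, `E3` is
closed. It is therefore exact, and its primitive is the potential `ψ` (`exists_potential`,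
`mem_hopfDivFree_iff`). On `S²` a divergence-free `v` likewise gives a closed one-form with value
`vᵢ` on the rotation field `eᵢ × p`, and its primitive is a stream function (`exists_eq_hamField`).

Both forms live on a punctured Euclidean space of dimension at least three. The complements of two
opposite closed rays are star-convex, so the Poincaré lemma applies on each. They overlap in the
complement of a line, which is connected, so the two primitives can be glued
(`exists_primitive_compl_zero`).

A function killed by `E1` is constant on Hopf circles. It descends to a smooth function on `S²`
because the cone over the Hopf map has two explicit smooth sections without common zero
(`exists_hopfPullback_eq`).

Along `E2` and `E3` the Hopf map has as derivatives a positively oriented orthonormal frame of the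
tangent plane of `S²`, whence `π^*{f,h} = E₂f̃ E₃h̃ - E₃f̃ E₂h̃` (`hopfPullback_poisson`). As `π^*`
is injective, skew symmetry and the Jacobi identity for the Poisson bracket follow from computations
in the frame. The same calculus computes brackets of fields in normal form (`lie_formField`): the
potentials combine by the Poisson bracket, and `[E2,E3] = -E1` leaves `-{ψ₁,ψ₂}` in the `E1`
component, which is the cocycle. Stream functions are not unique, but only `X_ψ` enters the
formulas, so any linear choice of them gives the isomorphism. -/

noncomputable section

namespace SphereFlow

/-! ### Differential calculus on the sphere through extensions -/

section

variable {n : ℕ} {F : Type*} [NormedAddCommGroup F] [NormedSpace ℝ F]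

/-- The identity map is `‖y‖ • (‖y‖⁻¹ • y)`; the product rule for such a factorization, solved for
the derivative of the second factor, gives the orthogonal projection onto `p^⊥`. -/
theorem hasFDerivAt_normalize (p : Sph n) :
    HasFDerivAt (fun y : Amb n => ‖y‖⁻¹ • y)
      (ContinuousLinearMap.id ℝ (Amb n) - (innerSL ℝ (p : Amb n)).smulRight (p : Amb n)) p := by
  have hp : ‖(p : Amb n)‖ = 1 := by simp
  have h0 := coe_ne_zero p
  have hd : DifferentiableAt ℝ (fun y : Amb n => ‖y‖⁻¹ • y) p :=
    (((contDiffAt_norm (n := 1) ℝ h0).inv (by simp)).smul contDiffAt_id).differentiableAt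
      (by simp)
  refine hd.hasFDerivAt.congr_fderiv ?_
  ext1 v
  have := fderiv_eq_of_norm_smul p (h := fun y : Amb n => y) hd
    (fun y hy => by rw [smul_smul, mul_inv_cancel₀ (by simpa using hy), one_smul]) v
  simp only [fderiv_fun_id, ContinuousLinearMap.id_apply, hp, inv_one, one_smul] at this
  simp [eq_sub_iff_add_eq, ← this]

/-- Tangential derivatives of a function on the sphere may be computed with any extension. -/
theorem fderiv_radialExt_of_restrict {f : Sph n → F} {h : Amb n → F} (hf : ∀ p : Sph n, f p = h p)
    (p : Sph n) (hh : DifferentiableAt ℝ h p) (v : Amb n) :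
    fderiv ℝ (radialExt f) p v = fderiv ℝ h p (v - ⟪(p : Amb n), v⟫_ℝ • (p : Amb n)) := by
  have hp : ‖(p : Amb n)‖ = 1 := by simp
  have h0 := coe_ne_zero p
  have e : radialExt f =ᶠ[nhds (p : Amb n)] h ∘ fun y => ‖y‖⁻¹ • y := by
    filter_upwards [isOpen_ne.mem_nhds h0] with y hy
    obtain ⟨q, hq, hfq⟩ := exists_radial F hy
    rw [hfq, hf, hq]; rfl
  have h1 : HasFDerivAt h (fderiv ℝ h p) (‖(p : Amb n)‖⁻¹ • (p : Amb n)) := by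
    rw [hp, inv_one, one_smul]; exact hh.hasFDerivAt
  rw [e.fderiv_eq, (HasFDerivAt.comp (f := fun y : Amb n => ‖y‖⁻¹ • y) (p : Amb n) h1
    (hasFDerivAt_normalize p)).fderiv]
  simp

theorem fderiv_radialExt_of_restrict_of_inner_eq_zero {f : Sph n → F} {h : Amb n → F}
    (hf : ∀ p : Sph n, f p = h p) (p : Sph n) (hh : DifferentiableAt ℝ h p) {v : Amb n}
    (hv : ⟪(p : Amb n), v⟫_ℝ = 0) : fderiv ℝ (radialExt f) p v = fderiv ℝ h p v := by
  rw [fderiv_radialExt_of_restrict hf p hh, hv]; simp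

theorem fderiv_radialExt_self (f : Sph n → F) {y : Amb n} (hd : DifferentiableAt ℝ (radialExt f) y) :
    fderiv ℝ (radialExt f) y y = 0 := by
  have h1 : HasDerivAt (fun t : ℝ => radialExt f (t • y)) (fderiv ℝ (radialExt f) y y) 1 := by
    have h2 : HasDerivAt (fun t : ℝ => t • y) y 1 := by
      simpa using (hasDerivAt_id (1 : ℝ)).smul_const y
    have h3 : HasFDerivAt (radialExt f) (fderiv ℝ (radialExt f) y) ((1 : ℝ) • y) := by
      simpa using hd.hasFDerivAt
    exact h3.comp_hasDerivAt 1 h2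
  have h4 : (fun t : ℝ => radialExt f (t • y)) =ᶠ[nhds 1] fun _ => radialExt f y := by
    filter_upwards [lt_mem_nhds (zero_lt_one' ℝ)] with t ht using radialExt_smul f ht y
  exact h1.unique ((hasDerivAt_const 1 _).congr_of_eventuallyEq h4)

/-- The restriction to the sphere of a function that is smooth away from the origin. -/
def restrictFun (h : Amb n → ℝ) (hh : ∀ y, y ≠ 0 → ContDiffAt ℝ ∞ h y) : SmoothFun n :=
  ⟨fun p => h p, contMDiff_restrict hh⟩

namespace VF

theorem inner_coe (X : VF n) (p : Sph n) : ⟪(p : Amb n), X.1 p⟫_ℝ = 0 := by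
  rw [real_inner_comm]; exact X.2 p

theorem ext0_coe (X : VF n) (p : Sph n) : X.ext0 p = X.1 p := radialExt_coe _ p

theorem lie_eq_of_restrict (X : VF n) {f : SmoothFun n} {h : Amb n → ℝ}
    (hf : ∀ p : Sph n, f p = h p) (p : Sph n) (hh : DifferentiableAt ℝ h p) :
    ⁅X, f⁆ p = fderiv ℝ h p (X.1 p) := by
  rw [lie_fun_apply, ext0_coe,
    fderiv_radialExt_of_restrict_of_inner_eq_zero hf p hh (X.inner_coe p)]

/-- A vector field is determined by its action on functions. -/
theorem ext_of_lie {X Y : VF n} (h : ∀ f : SmoothFun n, ⁅X, f⁆ = ⁅Y, f⁆) : X = Y := by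
  refine vf_ext fun p => ?_
  ext i
  -- The coordinate functions suffice as tests: the derivative of the `i`-th one along a field is
  -- its `i`-th component.
  have hs : ContDiff ℝ ∞ (EuclideanSpace.proj i : Amb n →L[ℝ] ℝ) := ContinuousLinearMap.contDiff _
  have hi := DFunLike.congr_fun
    (h (restrictFun (EuclideanSpace.proj i : Amb n →L[ℝ] ℝ) fun _ _ => hs.contDiffAt)) p
  rw [lie_eq_of_restrict X (fun _ => rfl) p (ContinuousLinearMap.differentiableAt _),
    lie_eq_of_restrict Y (fun _ => rfl) p (ContinuousLinearMap.differentiableAt _),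
    ContinuousLinearMap.fderiv] at hi
  exact hi

theorem lie_mul (X : VF n) (f g : SmoothFun n) : ⁅X, f * g⁆ = f * ⁅X, g⁆ + g * ⁅X, f⁆ := by
  refine ContMDiffMap.ext fun p => ?_
  have e : radialExt (f * g) = fun y => radialExt f y * radialExt g y := by
    ext1 y; by_cases hy : y = 0 <;> simp [radialExt, hy]
  have h0 := coe_ne_zero p
  change fderiv ℝ (radialExt (f * g)) p (X.ext0 p) =
    f p * fderiv ℝ (radialExt g) p (X.ext0 p) + g p * fderiv ℝ (radialExt f) p (X.ext0 p)
  rw [e, fderiv_fun_mul ((smooth_fun f h0).differentiableAt (by simp))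
    ((smooth_fun g h0).differentiableAt (by simp)), radialExt_coe, radialExt_coe]
  simp

/-- The product of a function and a vector field. -/
def mulFun (f : SmoothFun n) (X : VF n) : VF n :=
  ⟨⟨fun p => f p • X.1 p, contMDiff_restrict (g := fun y => radialExt f y • X.ext0 y)
    (fun _ hy => (smooth_fun f hy).smul (X.smooth hy)) |>.congr fun p => by
      rw [radialExt_coe, ext0_coe]⟩, fun p => by
    change ⟪f p • X.1 p, (p : Amb n)⟫_ℝ = 0
    rw [real_inner_smul_left, X.2 p, mul_zero]⟩

theorem mulFun_apply (f : SmoothFun n) (X : VF n) (p : Sph n) : (mulFun f X).1 p = f p • X.1 p := rfl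

theorem ext0_mulFun (f : SmoothFun n) (X : VF n) :
    (mulFun f X).ext0 = fun y => radialExt f y • X.ext0 y := by
  ext1 y; by_cases hy : y = 0
  · simp [radialExt, hy]
  · simp [radialExt, hy, mulFun_apply]

theorem mulFun_lie (f : SmoothFun n) (X : VF n) (g : SmoothFun n) :
    ⁅mulFun f X, g⁆ = f * ⁅X, g⁆ := by
  refine ContMDiffMap.ext fun p => ?_
  change fderiv ℝ (radialExt g) p ((mulFun f X).ext0 p) =
    f p * fderiv ℝ (radialExt g) p (X.ext0 p)
  rw [ext0_coe, ext0_coe, mulFun_apply]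
  simp

theorem div_mulFun (f : SmoothFun n) (X : VF n) (p : Sph n) :
    (mulFun f X).div p = f p * X.div p + ⁅X, f⁆ p := by
  have h0 := coe_ne_zero p
  rw [div_eq_traceL, ext0_mulFun,
    fderiv_fun_smul ((smooth_fun f h0).differentiableAt (by simp)) (X.diff h0), map_add, map_smul,
    ← div_eq_traceL, radialExt_coe, traceL_apply, lie_fun_apply, smul_eq_mul]
  congr 1
  exact LinearMap.trace_smulRight (fderiv ℝ (radialExt f) p : Amb n →ₗ[ℝ] ℝ) (X.ext0 p)

end VF

end

/-! ### Closed one-forms on star-convex sets -/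

section Poincare

open Set

variable {E : Type*} [NormedAddCommGroup E] [NormedSpace ℝ E]

/-- The Poincaré lemma for closed one-forms on open star-convex sets. -/
theorem exists_primitive_of_starConvex {U : Set E} {a : E}
    (hU : IsOpen U) (hs : StarConvex ℝ a U) {α : E → E →L[ℝ] ℝ} (hα : DifferentiableOn ℝ α U)
    (hsymm : ∀ x ∈ U, ∀ v w, fderiv ℝ α x v w = fderiv ℝ α x w v) :
    ∃ f : E → ℝ, ∀ x ∈ U, HasFDerivAt f (α x) x := by
  refine ⟨fun b => ∫ᶜ x in .segment a b, α x, fun b hb => ?_⟩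
  -- `U` need not be convex, while the segment theorem needs a convex domain. A thin thickening of
  -- the compact segment is convex and stays inside `U`.
  have hc : IsCompact (segment ℝ a b) := by
    rw [segment_eq_image_lineMap]
    exact isCompact_Icc.image AffineMap.lineMap_continuous
  obtain ⟨δ, hδ, hV⟩ := hc.exists_thickening_subset_open hU (hs.segment_subset hb)
  set V := Metric.thickening δ (segment ℝ a b)
  have hVo : IsOpen V := Metric.isOpen_thickening
  have hsub : segment ℝ a b ⊆ V := Metric.self_subset_thickening hδ _
  have key := Convex.hasFDerivWithinAt_curveIntegral_segment_of_hasFDerivWithinAt_symmetric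
    (s := V) (dω := fderiv ℝ α) ((convex_segment a b).thickening δ)
    (fun x hx => ((hα.differentiableAt (hU.mem_nhds (hV hx))).hasFDerivAt).hasFDerivWithinAt)
    (fun x hx v _ w _ => hsymm x (hV hx) v w)
    (hsub (left_mem_segment ℝ a b)) (hsub (right_mem_segment ℝ a b))
  exact key.hasFDerivAt (hVo.mem_nhds (hsub (right_mem_segment ℝ a b)))

end Poincare

/-! ### Closed one-forms on the punctured space -/

section Slit

variable {E : Type*} [NormedAddCommGroup E] [InnerProductSpace ℝ E]

/-- Equality case of Cauchy–Schwarz: `‖y + ‖y‖ • N‖ ^ 2 = 2 * ‖y‖ * (‖y‖ + ⟪y, N⟫)`. -/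
theorem eq_neg_norm_smul {N y : E} (hN : ‖N‖ = 1) (h : ‖y‖ + ⟪y, N⟫_ℝ = 0) : y = -(‖y‖ • N) := by
  rw [eq_neg_iff_add_eq_zero, ← norm_eq_zero, ← sq_eq_zero_iff, norm_add_sq_real, norm_smul, hN,
    real_inner_smul_right]
  simp only [norm_norm]
  linear_combination 2 * ‖y‖ * h

/-- The complement of the closed ray through `-N`. -/
def slit (N : E) : Set E := {y | ‖y‖ + ⟪y, N⟫_ℝ ≠ 0}

theorem isOpen_slit (N : E) : IsOpen (slit N) :=
  isOpen_ne_fun (by fun_prop) continuous_const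

/-- If a point `s • N + t • b` lay on the removed ray, then `t • b` would be a nonpositive multiple
of `N`, and for `t > 0` so would `b`. For `t = 0` the point is `N` itself, which is not on the ray.
-/
theorem starConvex_slit {N : E} (hN : ‖N‖ = 1) : StarConvex ℝ N (slit N) := by
  intro b hb s t hs ht hst h
  have h1 := eq_neg_norm_smul hN h
  set c := ‖s • N + t • b‖
  have hc : 0 ≤ c := norm_nonneg _
  have h2 : t • b = (-(c + s)) • N := by
    rw [neg_smul, add_smul, neg_add, ← h1]; abel
  rcases ht.eq_or_lt with rfl | ht
  · have hs1 : s = 1 := by linarith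
    have h3 : c + s = 0 := by
      have hN0 : N ≠ 0 := by rintro rfl; simp at hN
      rw [zero_smul, eq_comm, smul_eq_zero, or_iff_left hN0] at h2
      linarith
    linarith
  · refine hb ?_
    have h3 : b = (-(t⁻¹ * (c + s))) • N := by
      rw [← inv_smul_smul₀ ht.ne' b, h2, smul_smul]; congr 1; ring
    have h4 : 0 ≤ t⁻¹ * (c + s) := by positivity
    rw [h3, norm_smul, real_inner_smul_left, real_inner_self_eq_norm_sq, hN, norm_neg,
      Real.norm_of_nonneg h4]
    ring

theorem mem_slit_or (N : E) {y : E} (hy : y ≠ 0) : y ∈ slit N ∨ y ∈ slit (-N) := by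
  by_contra! h
  obtain ⟨h1, h2⟩ := h
  simp only [slit, Set.mem_ofPred_eq, not_not, inner_neg_right] at h1 h2
  exact hy (norm_eq_zero.1 (by linarith))

theorem slit_inter_slit_neg {N : E} (hN : ‖N‖ = 1) :
    slit N ∩ slit (-N) = ((ℝ ∙ N : Submodule ℝ E) : Set E)ᶜ := by
  ext y
  simp only [Set.mem_inter_iff, Set.mem_compl_iff, SetLike.mem_coe, Submodule.mem_span_singleton]
  constructor
  · rintro ⟨h1, h2⟩ ⟨c, rfl⟩
    simp only [slit, Set.mem_ofPred_eq, norm_smul, real_inner_smul_left, hN, inner_neg_right,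
      real_inner_self_eq_norm_sq, Real.norm_eq_abs] at h1 h2
    rcases abs_choice c with h | h <;> rw [h] at h1 h2
    · exact h2 (by ring)
    · exact h1 (by ring)
  · intro h
    constructor
    · intro h1
      exact h ⟨-‖y‖, by rw [neg_smul, ← eq_neg_norm_smul hN h1]⟩
    · intro h1
      exact h ⟨‖y‖, by simpa using (eq_neg_norm_smul (by rwa [norm_neg]) h1).symm⟩

/-- A closed one-form on the punctured space is exact in dimension at least three. -/
theorem exists_primitive_compl_zero [FiniteDimensional ℝ E] (hdim : 2 < Module.finrank ℝ E)
    {α : E → E →L[ℝ] ℝ} (hα : ∀ y, y ≠ 0 → DifferentiableAt ℝ α y)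
    (hsymm : ∀ y, y ≠ 0 → ∀ v w, fderiv ℝ α y v w = fderiv ℝ α y w v) :
    ∃ f : E → ℝ, ∀ y, y ≠ 0 → HasFDerivAt f (α y) y := by
  have : Nontrivial E := Module.nontrivial_of_finrank_pos (R := ℝ) (by omega)
  obtain ⟨N, hN⟩ := exists_norm_eq E zero_le_one
  have hz : ∀ M : E, ∀ y ∈ slit M, y ≠ 0 := by rintro M y hy rfl; simp [slit] at hy
  have hex : ∀ M : E, ‖M‖ = 1 → ∃ f : E → ℝ, ∀ y ∈ slit M, HasFDerivAt f (α y) y := fun M hM =>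
    exists_primitive_of_starConvex (isOpen_slit M) (starConvex_slit hM)
      (fun y hy => (hα y (hz M y hy)).differentiableWithinAt) (fun y hy => hsymm y (hz M y hy))
  obtain ⟨f, hf⟩ := hex N hN
  obtain ⟨g, hg⟩ := hex (-N) (by rwa [norm_neg])
  -- The overlap is the complement of a line of codimension at least two; its connectedness leaves a
  -- single constant between the two primitives.
  have hconn : IsPreconnected (slit N ∩ slit (-N)) := by
    rw [slit_inter_slit_neg hN]
    refine (isConnected_compl_of_one_lt_codim ?_).isPreconnected
    rw [← Module.finrank_eq_rank, Nat.one_lt_cast]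
    have h1 := Submodule.finrank_quotient_add_finrank (ℝ ∙ N)
    have h2 := finrank_span_singleton (K := ℝ) (v := N) (by rintro rfl; simp at hN)
    omega
  obtain ⟨c, hc⟩ := ((isOpen_slit N).inter (isOpen_slit (-N))).exists_is_const_of_fderiv_eq_zero
    hconn (f := fun y => f y - g y)
    (fun y hy => ((hf y hy.1).sub (hg y hy.2)).differentiableAt.differentiableWithinAt)
    (fun y hy => by
      have := ((hf y hy.1).sub (hg y hy.2)).fderiv
      rw [sub_self] at this
      exact this)
  classical
  refine ⟨fun y => if y ∈ slit N then f y else g y + c, fun y hy => ?_⟩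
  rcases mem_slit_or N hy with h | h
  · refine (hf y h).congr_of_eventuallyEq ?_
    filter_upwards [(isOpen_slit N).mem_nhds h] with z hz
    rw [if_pos hz]
  · refine ((hg y h).add_const c).congr_of_eventuallyEq ?_
    filter_upwards [(isOpen_slit (-N)).mem_nhds h] with z hz
    split_ifs with h1
    · have := hc z ⟨h1, hz⟩
      linarith
    · rfl

theorem contDiffAt_of_hasFDerivAt_compl_zero {f : E → ℝ} {α : E → E →L[ℝ] ℝ}
    (hf : ∀ y, y ≠ 0 → HasFDerivAt f (α y) y) (hα : ∀ y, y ≠ 0 → ContDiffAt ℝ ∞ α y) {y : E}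
    (hy : y ≠ 0) : ContDiffAt ℝ ∞ f y := by
  have ho : IsOpen {y : E | y ≠ 0} := isOpen_ne
  have : ContDiffOn ℝ ∞ f {y : E | y ≠ 0} := by
    rw [contDiffOn_infty_iff_fderiv_of_isOpen ho]
    refine ⟨fun z hz => (hf z hz).differentiableAt.differentiableWithinAt, ?_⟩
    exact fun z hz => ((hα z hz).contDiffWithinAt).congr (fun x hx => (hf x hx).fderiv)
      (hf z hz).fderiv
  exact this.contDiffAt (ho.mem_nhds hy)

end Slit

/-! ### Linear fields and the frame of the three-sphere -/

section LinearField

variable (A B : Amb 3 →ₗ[ℝ] Amb 3) (hA : ∀ y, ⟪A y, y⟫_ℝ = 0) (hB : ∀ y, ⟪B y, y⟫_ℝ = 0)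

theorem linearField_apply (p : Sph 3) : (linearField A hA).1 p = A p := rfl

theorem ext0_linearField {y : Amb 3} (hy : y ≠ 0) : (linearField A hA).ext0 y = ‖y‖⁻¹ • A y := by
  obtain ⟨p, hp, h⟩ := exists_radial (Amb 3) hy
  rw [VF.ext0, h, linearField_apply, hp, map_smul]

theorem hasFDerivAt_linear (y : Amb 3) :
    HasFDerivAt (fun y => A y) (LinearMap.toContinuousLinearMap A) y :=
  (LinearMap.toContinuousLinearMap A).hasFDerivAt

theorem fderiv_ext0_linearField (p : Sph 3) (v : Amb 3) :
    fderiv ℝ (linearField A hA).ext0 p v = A v - ⟪(p : Amb 3), v⟫_ℝ • A p := by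
  rw [VF.ext0, fderiv_radialExt_of_restrict (linearField_apply A hA) p
    (hasFDerivAt_linear A p).differentiableAt, (hasFDerivAt_linear A p).fderiv]
  simp

theorem lie_linearField (p : Sph 3) :
    (⁅linearField A hA, linearField B hB⁆ : VF 3).1 p = B (A p) - A (B p) := by
  rw [VF.lie_apply, VectorField.lieBracket, fderiv_ext0_linearField, fderiv_ext0_linearField,
    VF.ext0_coe, VF.ext0_coe, VF.inner_coe, VF.inner_coe]
  simp [linearField_apply]

theorem div_linearField (p : Sph 3) : (linearField A hA).div p = 0 := by
  rw [VF.div, LinearMap.trace_eq_sum_inner _ (EuclideanSpace.basisFun (Fin 4) ℝ)]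
  have h : ∀ v : Amb 3, ⟪v, fderiv ℝ (linearField A hA).ext0 p v⟫_ℝ =
      -(⟪(p : Amb 3), v⟫_ℝ * ⟪v, A p⟫_ℝ) := fun v => by
    rw [fderiv_ext0_linearField, inner_sub_right, real_inner_comm, hA, real_inner_smul_right,
      zero_sub]
  refine (Finset.sum_congr rfl fun i _ => h _).trans ?_
  rw [Finset.sum_neg_distrib, OrthonormalBasis.sum_inner_mul_inner, real_inner_comm, hA, neg_zero]

/-- The derivative of a radial extension has degree `-1` and `A` has degree `1`. The scalings
cancel, so the formula holds off the sphere with no power of `‖y‖`. -/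
theorem fderiv_radialExt_linear (f : SmoothFun 3) {y : Amb 3} (hy : y ≠ 0) :
    fderiv ℝ (radialExt f) y (A y) = radialExt (⁅linearField A hA, f⁆ : SmoothFun 3) y := by
  have h : ‖y‖ ≠ 0 := by simpa using hy
  refine Eq.trans ?_ (VF.radialExt_deriv (linearField A hA) f hy).symm
  rw [ext0_linearField A hA hy, map_smul, smul_eq_mul, smul_eq_mul, mul_inv_cancel_left₀ h]

end LinearField

/-- The linear maps `y ↦ Eᵢ(y)` on `ℝ⁴`. -/
def frame : Fin 3 → Amb 3 →ₗ[ℝ] Amb 3 :=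
  ![Matrix.toEuclideanLin matE1, Matrix.toEuclideanLin matE2, Matrix.toEuclideanLin matE3]

theorem frame_zero (y : Amb 3) : frame 0 y = !₂[y 3 / 2, -y 2 / 2, y 1 / 2, -y 0 / 2] := by
  ext i
  fin_cases i <;> simp [frame, matE1, Matrix.toLpLin_apply, dotProduct, Fin.sum_univ_four] <;> ring

theorem frame_one (y : Amb 3) : frame 1 y = !₂[y 2 / 2, y 3 / 2, -y 0 / 2, -y 1 / 2] := by
  ext i
  fin_cases i <;> simp [frame, matE2, Matrix.toLpLin_apply, dotProduct, Fin.sum_univ_four] <;> ring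

theorem frame_two (y : Amb 3) : frame 2 y = !₂[-y 1 / 2, y 0 / 2, y 3 / 2, -y 2 / 2] := by
  ext i
  fin_cases i <;> simp [frame, matE3, Matrix.toLpLin_apply, dotProduct, Fin.sum_univ_four] <;> ring

theorem E1_apply (p : Sph 3) : E1.1 p = frame 0 p := rfl
theorem E2_apply (p : Sph 3) : E2.1 p = frame 1 p := rfl
theorem E3_apply (p : Sph 3) : E3.1 p = frame 2 p := rfl

theorem inner_amb3 (v w : Amb 3) :
    ⟪v, w⟫_ℝ = v 0 * w 0 + v 1 * w 1 + v 2 * w 2 + v 3 * w 3 := by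
  simp [PiLp.inner_apply, Fin.sum_univ_four]; ring

theorem norm_sq_amb3 (v : Amb 3) : ‖v‖ ^ 2 = v 0 ^ 2 + v 1 ^ 2 + v 2 ^ 2 + v 3 ^ 2 := by
  rw [EuclideanSpace.norm_sq_eq, Fin.sum_univ_four]; simp

theorem inner_frame (i j : Fin 3) (y : Amb 3) :
    ⟪frame i y, frame j y⟫_ℝ = if i = j then ‖y‖ ^ 2 / 4 else 0 := by
  rw [inner_amb3, norm_sq_amb3]
  fin_cases i <;> fin_cases j <;> simp [frame_zero, frame_one, frame_two] <;> ring

theorem inner_frame_self (i : Fin 3) (y : Amb 3) : ⟪frame i y, y⟫_ℝ = 0 := by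
  rw [inner_amb3]
  fin_cases i <;> simp [frame_zero, frame_one, frame_two] <;> ring

/-- The vectors `y` and `2 • frame i y` are orthogonal of common length `‖y‖`; this is the source of
the factor `4`. -/
theorem norm_sq_smul_eq_frame (y v : Amb 3) :
    ‖y‖ ^ 2 • v = ⟪y, v⟫_ℝ • y + (4 * ⟪frame 0 y, v⟫_ℝ) • frame 0 y
      + (4 * ⟪frame 1 y, v⟫_ℝ) • frame 1 y + (4 * ⟪frame 2 y, v⟫_ℝ) • frame 2 y := by
  simp only [inner_amb3, norm_sq_amb3]
  ext i
  fin_cases i <;> simp [frame_zero, frame_one, frame_two] <;> ring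

theorem exists_frame_coeff {y : Amb 3} (hy : y ≠ 0) (v : Amb 3) : ∃ c c₀ c₁ c₂ : ℝ,
    v = c • y + c₀ • frame 0 y + c₁ • frame 1 y + c₂ • frame 2 y := by
  have h : ‖y‖ ^ 2 ≠ 0 := by simpa using hy
  have e := norm_sq_smul_eq_frame y v
  rw [← eq_inv_smul_iff₀ h] at e
  simp only [smul_add, smul_smul] at e
  exact ⟨_, _, _, _, e⟩

/-- Doubling the three maps gives quaternion units with `IJ = K`, `JK = I`, `KI = J`. The brackets
of the frame fields are read off from these products. -/
theorem frame_one_frame_zero (y : Amb 3) : frame 1 (frame 0 y) = -((1 / 2 : ℝ) • frame 2 y) := by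
  ext i; fin_cases i <;> simp [frame_zero, frame_one, frame_two] <;> ring
theorem frame_zero_frame_one (y : Amb 3) : frame 0 (frame 1 y) = (1 / 2 : ℝ) • frame 2 y := by
  ext i; fin_cases i <;> simp [frame_zero, frame_one, frame_two] <;> ring
theorem frame_two_frame_one (y : Amb 3) : frame 2 (frame 1 y) = -((1 / 2 : ℝ) • frame 0 y) := by
  ext i; fin_cases i <;> simp [frame_zero, frame_one, frame_two] <;> ring
theorem frame_one_frame_two (y : Amb 3) : frame 1 (frame 2 y) = (1 / 2 : ℝ) • frame 0 y := by
  ext i; fin_cases i <;> simp [frame_zero, frame_one, frame_two] <;> ring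
theorem frame_zero_frame_two (y : Amb 3) : frame 0 (frame 2 y) = -((1 / 2 : ℝ) • frame 1 y) := by
  ext i; fin_cases i <;> simp [frame_zero, frame_one, frame_two] <;> ring
theorem frame_two_frame_zero (y : Amb 3) : frame 2 (frame 0 y) = (1 / 2 : ℝ) • frame 1 y := by
  ext i; fin_cases i <;> simp [frame_zero, frame_one, frame_two] <;> ring

theorem lie_E1_E2 : ⁅E1, E2⁆ = -E3 := VF.vf_ext fun p => by
  change _ = -(E3.1 p)
  refine (lie_linearField _ _ _ _ p).trans ?_
  change frame 1 (frame 0 p) - frame 0 (frame 1 p) = -frame 2 p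
  rw [frame_one_frame_zero, frame_zero_frame_one]; module

theorem lie_E2_E3 : ⁅E2, E3⁆ = -E1 := VF.vf_ext fun p => by
  change _ = -(E1.1 p)
  refine (lie_linearField _ _ _ _ p).trans ?_
  change frame 2 (frame 1 p) - frame 1 (frame 2 p) = -frame 0 p
  rw [frame_two_frame_one, frame_one_frame_two]; module

theorem lie_E1_E3 : ⁅E1, E3⁆ = E2 := VF.vf_ext fun p => by
  refine (lie_linearField _ _ _ _ p).trans ?_
  change frame 2 (frame 0 p) - frame 0 (frame 2 p) = frame 1 p
  rw [frame_two_frame_zero, frame_zero_frame_two]; module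

theorem lie_E1_lie_E2 (f : SmoothFun 3) : ⁅E1, ⁅E2, f⁆⁆ = ⁅E2, ⁅E1, f⁆⁆ - ⁅E3, f⁆ := by
  rw [leibniz_lie, lie_E1_E2, neg_lie]; abel

theorem lie_E1_lie_E3 (f : SmoothFun 3) : ⁅E1, ⁅E3, f⁆⁆ = ⁅E3, ⁅E1, f⁆⁆ + ⁅E2, f⁆ := by
  rw [leibniz_lie, lie_E1_E3]; abel

theorem lie_E3_lie_E2 (f : SmoothFun 3) : ⁅E3, ⁅E2, f⁆⁆ = ⁅E2, ⁅E3, f⁆⁆ + ⁅E1, f⁆ := by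
  rw [leibniz_lie E2, lie_E2_E3, neg_lie]; abel

/-- The vector field `c₁ E₁ + c₂ E₂ + c₃ E₃`. -/
def frameField (c₁ c₂ c₃ : SmoothFun 3) : VF 3 :=
  VF.mulFun c₁ E1 + VF.mulFun c₂ E2 + VF.mulFun c₃ E3

section FrameField

variable (c₁ c₂ c₃ : SmoothFun 3)

theorem frameField_apply (p : Sph 3) : (frameField c₁ c₂ c₃).1 p =
    c₁ p • frame 0 p + c₂ p • frame 1 p + c₃ p • frame 2 p := rfl

theorem frameField_lie (f : SmoothFun 3) :
    ⁅frameField c₁ c₂ c₃, f⁆ = c₁ * ⁅E1, f⁆ + c₂ * ⁅E2, f⁆ + c₃ * ⁅E3, f⁆ := by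
  rw [frameField, add_lie, add_lie, VF.mulFun_lie, VF.mulFun_lie, VF.mulFun_lie]

theorem div_frameField (p : Sph 3) :
    (frameField c₁ c₂ c₃).div p = (⁅E1, c₁⁆ + ⁅E2, c₂⁆ + ⁅E3, c₃⁆ : SmoothFun 3) p := by
  rw [frameField, VF.div_add, VF.div_add, VF.div_mulFun, VF.div_mulFun, VF.div_mulFun]
  have h1 : E1.div p = 0 := div_linearField _ _ p
  have h2 : E2.div p = 0 := div_linearField _ _ p
  have h3 : E3.div p = 0 := div_linearField _ _ p
  rw [h1, h2, h3]
  simp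

variable {c₁ c₂ c₃}

theorem frameField_inj {d₁ d₂ d₃ : SmoothFun 3} :
    frameField c₁ c₂ c₃ = frameField d₁ d₂ d₃ ↔ c₁ = d₁ ∧ c₂ = d₂ ∧ c₃ = d₃ := by
  refine ⟨fun h => ?_, by rintro ⟨rfl, rfl, rfl⟩; rfl⟩
  have key : ∀ (i : Fin 3) (p : Sph 3), ⟪frame i p, (frameField c₁ c₂ c₃).1 p⟫_ℝ =
    ⟪frame i p, (frameField d₁ d₂ d₃).1 p⟫_ℝ := fun i p => by rw [h]
  simp only [frameField_apply, inner_add_right, real_inner_smul_right, inner_frame] at key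
  refine ⟨ContMDiffMap.ext fun p => ?_, ContMDiffMap.ext fun p => ?_,
    ContMDiffMap.ext fun p => ?_⟩
  · simpa using key 0 p
  · simpa using key 1 p
  · simpa using key 2 p

theorem exists_eq_frameField (u : VF 3) : ∃ c₁ c₂ c₃, u = frameField c₁ c₂ c₃ := by
  let c : Fin 3 → SmoothFun 3 := fun i => restrictFun (fun y => 4 * ⟪frame i y, u.ext0 y⟫_ℝ)
    fun y hy => contDiffAt_const.mul
      (((frame i).toContinuousLinearMap.contDiff.contDiffAt).inner ℝ (u.smooth hy))
  refine ⟨c 0, c 1, c 2, VF.vf_ext fun p => ?_⟩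
  have hc : ∀ i, c i p = 4 * ⟪frame i p, u.1 p⟫_ℝ := fun i => by
    rw [← VF.ext0_coe]; rfl
  rw [frameField_apply, hc, hc, hc]
  have := norm_sq_smul_eq_frame p (u.1 p)
  rw [VF.inner_coe] at this
  simpa using this

/-- The undifferentiated terms `c₃` and `-c₂` come from `[E1,E3] = E2` and `[E1,E2] = -E3`. -/
theorem lie_E1_frameField : ⁅E1, frameField c₁ c₂ c₃⁆ =
    frameField ⁅E1, c₁⁆ (⁅E1, c₂⁆ + c₃) (⁅E1, c₃⁆ - c₂) := by
  refine VF.ext_of_lie fun f => ?_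
  rw [lie_lie, frameField_lie, frameField_lie, frameField_lie, lie_add, lie_add, VF.lie_mul,
    VF.lie_mul, VF.lie_mul, lie_E1_lie_E2, lie_E1_lie_E3]
  ring

theorem hasForm_iff {u : VF 3} {σ ψ : SmoothFun 3} :
    HasForm u σ ψ ↔ u = frameField σ (-⁅E3, ψ⁆) ⁅E2, ψ⁆ := by
  have e : ∀ p, (frameField σ (-⁅E3, ψ⁆) ⁅E2, ψ⁆).1 p =
      σ p • E1.1 p - ⁅E3, ψ⁆ p • E2.1 p + ⁅E2, ψ⁆ p • E3.1 p := fun p => by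
    rw [frameField_apply, sub_eq_add_neg, ← neg_smul]; rfl
  constructor
  · intro h
    exact VF.vf_ext fun p => (h p).trans (e p).symm
  · rintro rfl p
    exact e p

theorem frameField_mem_hopfDivFree_iff : frameField c₁ c₂ c₃ ∈ hopfDivFree ↔
    ⁅E1, c₁⁆ = 0 ∧ ⁅E1, c₂⁆ = -c₃ ∧ ⁅E1, c₃⁆ = c₂ ∧ ⁅E2, c₂⁆ + ⁅E3, c₃⁆ = 0 := by
  have hdiv : frameField c₁ c₂ c₃ ∈ divFree 3 ↔ ⁅E1, c₁⁆ + ⁅E2, c₂⁆ + ⁅E3, c₃⁆ = 0 := by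
    constructor
    · intro h
      exact ContMDiffMap.ext fun p => (div_frameField _ _ _ p).symm.trans (h p)
    · intro h p
      rw [div_frameField, h]; rfl
  have hz : (0 : VF 3) = frameField 0 0 0 := VF.vf_ext fun p => by
    rw [frameField_apply]; simp
  change _ ∧ ⁅E1, frameField c₁ c₂ c₃⁆ = 0 ↔ _
  rw [hdiv, lie_E1_frameField, hz, frameField_inj, sub_eq_zero,
    ← eq_neg_iff_add_eq_zero (a := (⁅E1, c₂⁆ : SmoothFun 3))]
  constructor
  · rintro ⟨h, h1, h2, h3⟩
    exact ⟨h1, h2, h3, by rwa [h1, zero_add] at h⟩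
  · rintro ⟨h1, h2, h3, h⟩
    exact ⟨by rw [h1, zero_add, h], h1, h2, h3⟩

end FrameField

/-! ### The potential of an invariant divergence-free field -/

section Potential

variable {E : Type*} [NormedAddCommGroup E] [NormedSpace ℝ E]

/-- Product rule for `z ↦ α z (B z)`. It gives the derivative of a one-form that is known only
through its values on linear fields. -/
theorem fderiv_apply_linear {α : E → E →L[ℝ] ℝ} {y : E} (hα : DifferentiableAt ℝ α y)
    {B : E →L[ℝ] E} {g : E → ℝ} (hg : ∀ᶠ z in nhds y, α z (B z) = g z) (v : E) :
    fderiv ℝ α y v (B y) = fderiv ℝ g y v - α y (B v) := by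
  have e : g =ᶠ[nhds y] fun z => α z (B z) := hg.mono fun z hz => hz.symm
  rw [e.fderiv_eq, fderiv_clm_apply hα B.differentiableAt]
  simp

end Potential

/-- An `E₁`-basic one-form on `S³` that is closed is exact. -/
theorem exists_potential {a b : SmoothFun 3} (h1 : ⁅E1, a⁆ = -b) (h2 : ⁅E1, b⁆ = a)
    (h3 : ⁅E2, b⁆ = ⁅E3, a⁆) : ∃ ψ : SmoothFun 3, ⁅E1, ψ⁆ = 0 ∧ ⁅E2, ψ⁆ = a ∧ ⁅E3, ψ⁆ = b := by
  let L : Fin 3 → Amb 3 →L[ℝ] Amb 3 := fun i => (frame i).toContinuousLinearMap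
  -- The form vanishing on `y` and `frame 0 y`, with values `a` and `b` on `frame 1 y` and `frame 2
  -- y`; the factor `4 / ‖y‖ ^ 2` inverts `‖frame i y‖ ^ 2`.
  let α : Amb 3 → Amb 3 →L[ℝ] ℝ := fun y => (4 * (‖y‖ ^ 2)⁻¹) •
    (radialExt a y • innerSL ℝ (L 1 y) + radialExt b y • innerSL ℝ (L 2 y))
  have hα : ∀ y, y ≠ 0 → ContDiffAt ℝ ∞ α y := fun y hy => by
    have hl : ∀ i, ContDiffAt ℝ ∞ (fun y => innerSL ℝ (L i y)) y := fun i =>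
      ((innerSL ℝ).contDiff.comp (L i).contDiff).contDiffAt
    exact (contDiffAt_const.mul (((contDiff_norm_sq ℝ).contDiffAt).inv (by simpa using hy))).smul
      (((VF.smooth_fun a hy).smul (hl 1)).add ((VF.smooth_fun b hy).smul (hl 2)))
  have hαv : ∀ y v, α y v = 4 * (‖y‖ ^ 2)⁻¹ *
      (radialExt a y * ⟪frame 1 y, v⟫_ℝ + radialExt b y * ⟪frame 2 y, v⟫_ℝ) := fun y v => by
    simp [α, L]; ring
  have hs : ∀ y, α y y = 0 := fun y => by simp [hαv, inner_frame_self]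
  have h0 : ∀ y, α y (L 0 y) = 0 := fun y => by simp [hαv, L, inner_frame]
  have ha : ∀ y, y ≠ 0 → α y (L 1 y) = radialExt a y := fun y hy => by
    have : ‖y‖ ≠ 0 := by simpa using hy
    rw [hαv]
    change _ * (_ * ⟪frame 1 y, frame 1 y⟫_ℝ + _ * ⟪frame 2 y, frame 1 y⟫_ℝ) = _
    rw [inner_frame, inner_frame, if_pos rfl, if_neg (by decide)]
    field_simp; ring
  have hb : ∀ y, y ≠ 0 → α y (L 2 y) = radialExt b y := fun y hy => by
    have : ‖y‖ ≠ 0 := by simpa using hy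
    rw [hαv]
    change _ * (_ * ⟪frame 1 y, frame 2 y⟫_ℝ + _ * ⟪frame 2 y, frame 2 y⟫_ℝ) = _
    rw [inner_frame, inner_frame, if_pos rfl, if_neg (by decide)]
    field_simp; ring
  have hsymm : ∀ y, y ≠ 0 → ∀ v w, fderiv ℝ α y v w = fderiv ℝ α y w v := by
    intro y hy
    have hd : DifferentiableAt ℝ α y := (hα y hy).differentiableAt (by simp)
    have hn : ∀ᶠ z in nhds y, z ≠ 0 := isOpen_ne.mem_nhds hy
    have D : ∀ v, fderiv ℝ α y v y = - α y v := fun v => by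
      have := fderiv_apply_linear hd (B := .id ℝ _) (g := fun _ => 0) (.of_forall hs) v
      simpa using this
    have D0 : ∀ v, fderiv ℝ α y v (frame 0 y) = - α y (frame 0 v) := fun v => by
      have := fderiv_apply_linear hd (B := L 0) (g := fun _ => 0) (.of_forall h0) v
      rw [fderiv_fun_const, Pi.zero_apply, zero_apply, zero_sub] at this
      exact this
    have D1 : ∀ v, fderiv ℝ α y v (frame 1 y) = fderiv ℝ (radialExt a) y v - α y (frame 1 v) :=
      fderiv_apply_linear hd (B := L 1) (hn.mono ha)
    have D2 : ∀ v, fderiv ℝ α y v (frame 2 y) = fderiv ℝ (radialExt b) y v - α y (frame 2 v) :=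
      fderiv_apply_linear hd (B := L 2) (hn.mono hb)
    have F0 : ∀ f : SmoothFun 3, fderiv ℝ (radialExt f) y (frame 0 y) = radialExt (⁅E1, f⁆ : SmoothFun 3) y :=
      fun f => fderiv_radialExt_linear _ _ f hy
    have F1 : ∀ f : SmoothFun 3, fderiv ℝ (radialExt f) y (frame 1 y) = radialExt (⁅E2, f⁆ : SmoothFun 3) y :=
      fun f => fderiv_radialExt_linear _ _ f hy
    have F2 : ∀ f : SmoothFun 3, fderiv ℝ (radialExt f) y (frame 2 y) = radialExt (⁅E3, f⁆ : SmoothFun 3) y :=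
      fun f => fderiv_radialExt_linear _ _ f hy
    have F : ∀ f : SmoothFun 3, fderiv ℝ (radialExt f) y y = 0 := fun f =>
      fderiv_radialExt_self f ((VF.smooth_fun f hy).differentiableAt (by simp))
    have a0 : α y (frame 0 y) = 0 := h0 y
    have a1 : α y (frame 1 y) = radialExt a y := ha y hy
    have a2 : α y (frame 2 y) = radialExt b y := hb y hy
    have hneg : radialExt (-b : SmoothFun 3) y = - radialExt b y := by simp [radialExt, hy]
    -- By bilinearity it is enough to compare the two sides on the spanning vectors `y`, `frame i
    -- y`; there the hypotheses on `a` and `b` are the closedness equations.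
    intro v w
    obtain ⟨c, c0, c1, c2, rfl⟩ := exists_frame_coeff hy v
    obtain ⟨d, d0, d1, d2, rfl⟩ := exists_frame_coeff hy w
    simp only [map_add, map_smul, add_apply, smul_apply,
      D, D0, D1, D2, F, F0, F1, F2, frame_one_frame_zero, frame_zero_frame_one,
      frame_two_frame_one, frame_one_frame_two, frame_zero_frame_two, frame_two_frame_zero,
      map_neg, a0, a1, a2, h1, h2, h3, hneg, hs, smul_eq_mul]
    ring
  obtain ⟨f, hf⟩ := exists_primitive_compl_zero (by simp)
    (fun y hy => (hα y hy).differentiableAt (by simp)) hsymm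
  have hfs := fun y hy => contDiffAt_of_hasFDerivAt_compl_zero hf hα (y := y) hy
  have key : ∀ (X : VF 3) p, ⁅X, restrictFun f hfs⁆ p = α p (X.1 p) := fun X p => by
    rw [VF.lie_eq_of_restrict X (fun _ => rfl) p (hf p (coe_ne_zero p)).differentiableAt,
      (hf p (coe_ne_zero p)).fderiv]
  refine ⟨restrictFun f hfs, ContMDiffMap.ext fun p => ?_, ContMDiffMap.ext fun p => ?_,
    ContMDiffMap.ext fun p => ?_⟩
  · exact (key E1 p).trans (h0 p)
  · exact (key E2 p).trans ((ha p (coe_ne_zero p)).trans (radialExt_coe _ p))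
  · exact (key E3 p).trans ((hb p (coe_ne_zero p)).trans (radialExt_coe _ p))

theorem mem_hopfDivFree_iff (u : VF 3) : u ∈ hopfDivFree ↔
    ∃ σ ψ : SmoothFun 3, ⁅E1, σ⁆ = 0 ∧ ⁅E1, ψ⁆ = 0 ∧ HasForm u σ ψ := by
  simp only [hasForm_iff]
  constructor
  · intro hu
    obtain ⟨c₁, c₂, c₃, rfl⟩ := exists_eq_frameField u
    obtain ⟨h1, h2, h3, h4⟩ := frameField_mem_hopfDivFree_iff.1 hu
    -- In the normal form `c₃ = E₂ψ` and `c₂ = -E₃ψ`, which dictates the prescribed derivatives `a =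
    -- c₃` and `b = -c₂`.
    obtain ⟨ψ, p1, p2, p3⟩ := exists_potential (a := c₃) (b := -c₂) (by rw [h3, neg_neg])
      (by rw [lie_neg, h2, neg_neg]) (by rw [lie_neg, neg_eq_iff_add_eq_zero, h4])
    exact ⟨c₁, ψ, h1, p1, by rw [p2, p3, neg_neg]⟩
  · rintro ⟨σ, ψ, hσ, hψ, rfl⟩
    refine frameField_mem_hopfDivFree_iff.2 ⟨hσ, ?_, ?_, ?_⟩
    · rw [lie_neg, lie_E1_lie_E3, hψ, lie_zero, zero_add]
    · rw [lie_E1_lie_E2, hψ, lie_zero, zero_sub]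
    · rw [lie_E3_lie_E2, hψ, lie_neg]; abel

/-! ### Hamiltonian fields on the two-sphere -/

theorem cross_zero (a b : Amb 2) : cross a b 0 = a 1 * b 2 - a 2 * b 1 := by
  simp [cross, cross_apply]
theorem cross_one (a b : Amb 2) : cross a b 1 = a 2 * b 0 - a 0 * b 2 := by
  simp [cross, cross_apply]
theorem cross_two (a b : Amb 2) : cross a b 2 = a 0 * b 1 - a 1 * b 0 := by
  simp [cross, cross_apply]

theorem inner_amb2 (v w : Amb 2) : ⟪v, w⟫_ℝ = v 0 * w 0 + v 1 * w 1 + v 2 * w 2 := by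
  simp [PiLp.inner_apply, Fin.sum_univ_three]; ring

theorem norm_sq_amb2 (v : Amb 2) : ‖v‖ ^ 2 = v 0 ^ 2 + v 1 ^ 2 + v 2 ^ 2 := by
  rw [EuclideanSpace.norm_sq_eq, Fin.sum_univ_three]; simp

/-- The infinitesimal rotations `y ↦ eᵢ × y` of `ℝ³`. -/
def rot : Fin 3 → Amb 2 →ₗ[ℝ] Amb 2 :=
  ![Matrix.toEuclideanLin !![0, 0, 0; 0, 0, -1; 0, 1, 0],
    Matrix.toEuclideanLin !![0, 0, 1; 0, 0, 0; -1, 0, 0],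
    Matrix.toEuclideanLin !![0, -1, 0; 1, 0, 0; 0, 0, 0]]

theorem rot_zero (y : Amb 2) : rot 0 y = !₂[0, -y 2, y 1] := by
  ext i; fin_cases i <;> simp [rot, Matrix.toLpLin_apply, dotProduct, Fin.sum_univ_three]

theorem rot_one (y : Amb 2) : rot 1 y = !₂[y 2, 0, -y 0] := by
  ext i; fin_cases i <;> simp [rot, Matrix.toLpLin_apply, dotProduct, Fin.sum_univ_three]

theorem rot_two (y : Amb 2) : rot 2 y = !₂[-y 1, y 0, 0] := by
  ext i; fin_cases i <;> simp [rot, Matrix.toLpLin_apply, dotProduct, Fin.sum_univ_three]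

theorem rot_zero_eq (y : Amb 2) : rot 0 y = -y 2 • EuclideanSpace.single 1 1
    + y 1 • EuclideanSpace.single 2 1 := by
  ext j; fin_cases j <;> simp [rot_zero]

theorem rot_one_eq (y : Amb 2) : rot 1 y = y 2 • EuclideanSpace.single 0 1
    + -y 0 • EuclideanSpace.single 2 1 := by
  ext j; fin_cases j <;> simp [rot_one]

theorem rot_two_eq (y : Amb 2) : rot 2 y = -y 1 • EuclideanSpace.single 0 1
    + y 0 • EuclideanSpace.single 1 1 := by
  ext j; fin_cases j <;> simp [rot_two]

theorem rot_one_rot_zero (y : Amb 2) : rot 1 (rot 0 y) = rot 0 (rot 1 y) - rot 2 y := by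
  ext i; fin_cases i <;> simp [rot_zero, rot_one, rot_two]

theorem rot_two_rot_one (y : Amb 2) : rot 2 (rot 1 y) = rot 1 (rot 2 y) - rot 0 y := by
  ext i; fin_cases i <;> simp [rot_zero, rot_one, rot_two]

theorem rot_zero_rot_two (y : Amb 2) : rot 0 (rot 2 y) = rot 2 (rot 0 y) - rot 1 y := by
  ext i; fin_cases i <;> simp [rot_zero, rot_one, rot_two]

/-- The Binet–Cauchy identity for `(a × y) · (eᵢ × y)`. -/
theorem inner_cross_rot (a y : Amb 2) (i : Fin 3) :
    ⟪cross a y, rot i y⟫_ℝ = ‖y‖ ^ 2 * a i - ⟪a, y⟫_ℝ * y i := by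
  simp only [inner_amb2, norm_sq_amb2, cross_zero, cross_one, cross_two]
  fin_cases i <;> simp [rot_zero, rot_one, rot_two] <;> ring

theorem inner_rot_eq_cross (a y : Amb 2) (i : Fin 3) : ⟪a, rot i y⟫_ℝ = cross y a i := by
  rw [inner_amb2]
  fin_cases i <;> simp [rot_zero, rot_one, rot_two, cross_zero, cross_one, cross_two] <;> ring

theorem inner_cross_self_right (a y : Amb 2) : ⟪cross a y, y⟫_ℝ = 0 := by
  rw [inner_amb2, cross_zero, cross_one, cross_two]; ring

theorem inner_cross_rotate (a b c : Amb 2) : ⟪a, cross b c⟫_ℝ = ⟪b, cross c a⟫_ℝ := by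
  simp only [inner_amb2, cross_zero, cross_one, cross_two]; ring

/-- The last three terms add up to `(y × v) × y`. The rotation fields are linearly dependent at each
point, but together with `y` they span, which is all that is needed in place of a frame. -/
theorem norm_sq_smul_eq_rot (y v : Amb 2) :
    ‖y‖ ^ 2 • v = ⟪y, v⟫_ℝ • y + cross y v 0 • rot 0 y + cross y v 1 • rot 1 y
      + cross y v 2 • rot 2 y := by
  simp only [inner_amb2, norm_sq_amb2, cross_zero, cross_one, cross_two]
  ext i
  fin_cases i <;> simp [rot_zero, rot_one, rot_two] <;> ring

theorem exists_rot_coeff {y : Amb 2} (hy : y ≠ 0) (v : Amb 2) : ∃ c c₀ c₁ c₂ : ℝ,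
    v = c • y + c₀ • rot 0 y + c₁ • rot 1 y + c₂ • rot 2 y := by
  have h : ‖y‖ ^ 2 ≠ 0 := by simpa using hy
  have e := norm_sq_smul_eq_rot y v
  rw [← eq_inv_smul_iff₀ h] at e
  simp only [smul_add, smul_smul] at e
  exact ⟨_, _, _, _, e⟩

theorem inner_gradient_left (f : Amb 2 → ℝ) (y v : Amb 2) : ⟪∇ f y, v⟫_ℝ = fderiv ℝ f y v := by
  rw [gradient, InnerProductSpace.toDual_symm_apply]

theorem hamField_apply (ψ : SmoothFun 2) (p : Sph 2) (i : Fin 3) :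
    (hamField ψ).1 p i = fderiv ℝ (radialExt ψ) p (rot i p) := by
  change cross p (∇ (radialExt ψ) p) i = _
  rw [← inner_rot_eq_cross, inner_gradient_left]

theorem ext0_hamField (ψ : SmoothFun 2) {y : Amb 2} (hy : y ≠ 0) (i : Fin 3) :
    (hamField ψ).ext0 y i = fderiv ℝ (radialExt ψ) y (rot i y) := by
  have hc : ‖y‖ ≠ 0 := by simpa using hy
  obtain ⟨p, hp, h⟩ := exists_radial (Amb 2) hy
  rw [VF.ext0, h, hamField_apply, hp, fderiv_radialExt_smul _ (by positivity), map_smul]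
  simp [hc]

theorem traceL_eq_sum (A : Amb 2 →L[ℝ] Amb 2) : VF.traceL 2 A =
    A (EuclideanSpace.single 0 1) 0 + A (EuclideanSpace.single 1 1) 1
      + A (EuclideanSpace.single 2 1) 2 := by
  rw [VF.traceL_apply, LinearMap.trace_eq_sum_inner _ (EuclideanSpace.basisFun (Fin 3) ℝ)]
  simp [Fin.sum_univ_three, EuclideanSpace.inner_single_left]

theorem fderiv_coord {E : Type*} [NormedAddCommGroup E] [NormedSpace ℝ E] {f : E → Amb 2} {y : E}
    (hf : DifferentiableAt ℝ f y) (v : E) (i : Fin 3) : fderiv ℝ (fun z => f z i) y v = fderiv ℝ f y v i := by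
  have := ((EuclideanSpace.proj i : Amb 2 →L[ℝ] ℝ).hasFDerivAt.comp y hf.hasFDerivAt).fderiv
  exact DFunLike.congr_fun this v

/-- The divergence is the sum over `i` of `D²ψ(eᵢ, eᵢ × p) + Dψ(eᵢ × eᵢ)`. The second terms vanish,
and the first cancel in pairs by symmetry of the second derivative. -/
theorem hamField_mem_divFree (ψ : SmoothFun 2) : hamField ψ ∈ divFree 2 := by
  intro p
  have h0 := coe_ne_zero p
  have hs := VF.smooth_fun ψ h0
  have hd : DifferentiableAt ℝ (fderiv ℝ (radialExt ψ)) p :=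
    (hs.fderiv_right (m := ∞) (by simp)).differentiableAt (by simp)
  have hsymm : IsSymmSndFDerivAt ℝ (radialExt ψ) p :=
    hs.isSymmSndFDerivAt (by simpa using two_le_smooth)
  have key : ∀ i v, fderiv ℝ (hamField ψ).ext0 p v i =
      fderiv ℝ (fderiv ℝ (radialExt ψ)) p v (rot i p) + fderiv ℝ (radialExt ψ) p (rot i v) := by
    intro i v
    have e : (fun y => fderiv ℝ (radialExt ψ) y ((rot i).toContinuousLinearMap y))
        =ᶠ[nhds (p : Amb 2)] fun y => (hamField ψ).ext0 y i := by
      filter_upwards [isOpen_ne.mem_nhds h0] with y hy using (ext0_hamField ψ hy i).symm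
    rw [← fderiv_coord ((hamField ψ).diff h0), ← e.fderiv_eq,
      fderiv_clm_apply hd (ContinuousLinearMap.differentiableAt _), ContinuousLinearMap.fderiv]
    exact add_comm _ _
  have r : ∀ i, rot i (EuclideanSpace.single i 1) = 0 := fun i => by
    ext j; fin_cases i <;> fin_cases j <;> simp [rot_zero, rot_one, rot_two]
  rw [VF.div_eq_traceL, traceL_eq_sum, key, key, key, r, r, r, rot_zero_eq, rot_one_eq, rot_two_eq]
  simp only [map_add, map_smul, map_zero, smul_eq_mul]
  rw [hsymm (EuclideanSpace.single 1 1) (EuclideanSpace.single 0 1),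
    hsymm (EuclideanSpace.single 2 1) (EuclideanSpace.single 0 1),
    hsymm (EuclideanSpace.single 2 1) (EuclideanSpace.single 1 1)]
  ring

theorem lie_hamField (ψ σ : SmoothFun 2) : ⁅hamField ψ, σ⁆ = poisson ψ σ := by
  refine ContMDiffMap.ext fun p => ?_
  change fderiv ℝ (radialExt σ) p ((hamField ψ).ext0 p) =
    ⟪(p : Amb 2), cross (∇ (radialExt ψ) p) (∇ (radialExt σ) p)⟫_ℝ
  rw [VF.ext0_coe, ← inner_gradient_left, inner_cross_rotate, inner_cross_rotate, real_inner_comm]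
  rw [real_inner_comm]
  rfl

/-- Every divergence-free vector field on `S²` is Hamiltonian. -/
theorem exists_eq_hamField {v : VF 2} (hv : v ∈ divFree 2) : ∃ ψ : SmoothFun 2, v = hamField ψ := by
  let L : Fin 3 → Amb 2 →L[ℝ] Amb 2 := fun i => (rot i).toContinuousLinearMap
  -- If `v = y × g` with `g ⟂ y`, then `v × y = ‖y‖ ^ 2 • g`; so this is the only candidate for the
  -- differential of a stream function constant along rays.
  let α : Amb 2 → Amb 2 →L[ℝ] ℝ := fun y => (‖y‖ ^ 2)⁻¹ • innerSL ℝ (cross (v.ext0 y) y)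
  have hα : ∀ y, y ≠ 0 → ContDiffAt ℝ ∞ α y := fun y hy =>
    (((contDiff_norm_sq ℝ).contDiffAt).inv (by simpa using hy)).smul
      ((innerSL ℝ).contDiff.contDiffAt.comp y (smooth_cross (v.smooth hy) contDiffAt_id))
  have hαv : ∀ y w, α y w = (‖y‖ ^ 2)⁻¹ * ⟪cross (v.ext0 y) y, w⟫_ℝ := fun y w => by
    simp [α]
  have hs : ∀ y, α y y = 0 := fun y => by simp [hαv, inner_cross_self_right]
  have hL : ∀ i y, y ≠ 0 → α y (L i y) = v.ext0 y i := fun i y hy => by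
    have h : ‖y‖ ^ 2 ≠ 0 := by simpa using hy
    rw [hαv]
    change _ * ⟪cross (v.ext0 y) y, rot i y⟫_ℝ = _
    rw [inner_cross_rot, v.inner_ext, zero_mul, sub_zero, inv_mul_cancel_left₀ h]
  have hsymm : ∀ y, y ≠ 0 → ∀ w w', fderiv ℝ α y w w' = fderiv ℝ α y w' w := by
    intro y hy
    have hd : DifferentiableAt ℝ α y := (hα y hy).differentiableAt (by simp)
    have hn : ∀ᶠ z in nhds y, z ≠ 0 := isOpen_ne.mem_nhds hy
    have D : ∀ w, fderiv ℝ α y w y = - α y w := fun w => by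
      have := fderiv_apply_linear hd (B := .id ℝ _) (g := fun _ => 0) (.of_forall hs) w
      simpa using this
    set M := fderiv ℝ v.ext0 y with hM
    have DL : ∀ i w, fderiv ℝ α y w (rot i y) = M w i - α y (rot i w) := fun i w => by
      have := fderiv_apply_linear hd (B := L i) (hn.mono (hL i)) w
      rw [fderiv_coord (v.diff hy)] at this
      exact this
    have aL : ∀ i, α y (rot i y) = v.ext0 y i := fun i => hL i y hy
    have My : M y = 0 := fderiv_radialExt_self v.1 (v.diff hy)
    have tr := VF.trace_fderiv_eq_zero hv hy
    rw [← hM, traceL_eq_sum] at tr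
    have Mt : ∀ w, ⟪M w, y⟫_ℝ = -⟪v.ext0 y, w⟫_ℝ := fun w => by
      have h : fderiv ℝ (fun y => ⟪v.ext0 y, y⟫_ℝ) y w = 0 := by
        have : (fun y => ⟪v.ext0 y, y⟫_ℝ) = fun _ => 0 := by ext y; exact v.inner_ext y
        rw [this]; simp
      rw [fderiv_inner_apply ℝ (v.diff hy) differentiableAt_fun_id] at h
      simp at h
      linarith
    have Me := fun i => Mt (EuclideanSpace.single i 1)
    simp only [inner_amb2] at Me
    have M0 := Me 0
    have M1 := Me 1
    have M2 := Me 2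
    simp at M0 M1 M2
    -- Symmetry on a pair of rotations combines the vanishing of the trace with the tangency
    -- condition differentiated along the remaining axis.
    have K01 : fderiv ℝ α y (rot 0 y) (rot 1 y) = fderiv ℝ α y (rot 1 y) (rot 0 y) := by
      rw [DL, DL, rot_one_rot_zero, map_sub, aL, rot_zero_eq y, rot_one_eq y]
      simp only [map_add, map_smul, PiLp.add_apply, PiLp.smul_apply, smul_eq_mul]
      linear_combination M2 - y 2 * tr
    have K12 : fderiv ℝ α y (rot 1 y) (rot 2 y) = fderiv ℝ α y (rot 2 y) (rot 1 y) := by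
      rw [DL, DL, rot_two_rot_one, map_sub, aL, rot_one_eq y, rot_two_eq y]
      simp only [map_add, map_smul, PiLp.add_apply, PiLp.smul_apply, smul_eq_mul]
      linear_combination M0 - y 0 * tr
    have K20 : fderiv ℝ α y (rot 2 y) (rot 0 y) = fderiv ℝ α y (rot 0 y) (rot 2 y) := by
      rw [DL, DL, rot_zero_rot_two, map_sub, aL, rot_two_eq y, rot_zero_eq y]
      simp only [map_add, map_smul, PiLp.add_apply, PiLp.smul_apply, smul_eq_mul]
      linear_combination M1 - y 1 * tr
    have Dy : ∀ i, fderiv ℝ α y y (rot i y) = -v.ext0 y i := fun i => by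
      rw [DL, My, aL, PiLp.zero_apply, zero_sub]
    intro w w'
    obtain ⟨c, c0, c1, c2, rfl⟩ := exists_rot_coeff hy w
    obtain ⟨d, d0, d1, d2, rfl⟩ := exists_rot_coeff hy w'
    simp only [map_add, map_smul, add_apply, smul_apply, D, Dy, aL, hs, smul_eq_mul]
    linear_combination (c0 * d1 - c1 * d0) * K01 + (c1 * d2 - c2 * d1) * K12
      + (c2 * d0 - c0 * d2) * K20
  obtain ⟨f, hf⟩ := exists_primitive_compl_zero (by simp)
    (fun y hy => (hα y hy).differentiableAt (by simp)) hsymm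
  have hfs := fun y hy => contDiffAt_of_hasFDerivAt_compl_zero hf hα (y := y) hy
  refine ⟨restrictFun f hfs, VF.vf_ext fun p => ?_⟩
  ext i
  have hi : ⟪(p : Amb 2), rot i p⟫_ℝ = 0 := by
    rw [inner_rot_eq_cross]
    fin_cases i <;> simp [cross_zero, cross_one, cross_two] <;> ring
  rw [hamField_apply, fderiv_radialExt_of_restrict_of_inner_eq_zero (f := restrictFun f hfs)
    (h := f) (fun _ => rfl) p
    (hf p (coe_ne_zero p)).differentiableAt hi, (hf p (coe_ne_zero p)).fderiv, ← VF.ext0_coe]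
  exact (hL i p (coe_ne_zero p)).symm

/-! ### The differential of the Hopf map -/

/-- The derivative of the Hopf map along `E₂`. -/
def hopfE2 (q : Amb 3) : Amb 2 :=
  !₂[2 * (q 0 * q 2 - q 3 * q 1), 2 * (q 1 * q 2 + q 0 * q 3),
    q 2 ^ 2 + q 3 ^ 2 - q 0 ^ 2 - q 1 ^ 2]

/-- The derivative of the Hopf map along `E₃`. -/
def hopfE3 (q : Amb 3) : Amb 2 :=
  !₂[-2 * (q 0 * q 1 + q 2 * q 3), q 0 ^ 2 - q 1 ^ 2 - q 3 ^ 2 + q 2 ^ 2,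
    2 * (q 0 * q 3 - q 1 * q 2)]

theorem differentiable_hopfAmb : Differentiable ℝ hopfAmb := by
  rw [differentiable_euclidean]
  intro i
  fin_cases i <;> simp [hopfAmb] <;> fun_prop

theorem fderiv_hopfAmb (q v : Amb 3) : fderiv ℝ hopfAmb q v =
    !₂[2 * (q 3 * v 3 + q 0 * v 0 - q 1 * v 1 - q 2 * v 2),
      2 * (q 0 * v 1 + q 1 * v 0 - q 3 * v 2 - q 2 * v 3),
      2 * (q 0 * v 2 + q 2 * v 0 + q 3 * v 1 + q 1 * v 3)] := by
  have h : ∀ i, HasFDerivAt (fun y : Amb 3 => y i) (EuclideanSpace.proj i : Amb 3 →L[ℝ] ℝ) q :=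
    fun i => (EuclideanSpace.proj i : Amb 3 →L[ℝ] ℝ).hasFDerivAt
  have h0 := (((((h 3).pow 2).add ((h 0).pow 2)).sub ((h 1).pow 2)).sub ((h 2).pow 2)).fderiv
  have h1 := ((((h 0).mul (h 1)).sub ((h 3).mul (h 2))).const_mul 2).fderiv
  have h2 := ((((h 0).mul (h 2)).add ((h 3).mul (h 1))).const_mul 2).fderiv
  ext i
  rw [← fderiv_coord (differentiable_hopfAmb q)]
  fin_cases i
  · refine (DFunLike.congr_fun h0 v).trans ?_
    simp; ring
  · refine (DFunLike.congr_fun h1 v).trans ?_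
    simp; ring
  · refine (DFunLike.congr_fun h2 v).trans ?_
    simp; ring

theorem fderiv_hopfAmb_E1 (q : Amb 3) : fderiv ℝ hopfAmb q (frame 0 q) = 0 := by
  rw [fderiv_hopfAmb, frame_zero]
  ext i; fin_cases i <;> simp <;> ring

theorem fderiv_hopfAmb_E2 (q : Amb 3) : fderiv ℝ hopfAmb q (frame 1 q) = hopfE2 q := by
  rw [fderiv_hopfAmb, frame_one, hopfE2]
  ext i; fin_cases i <;> simp <;> ring

theorem fderiv_hopfAmb_E3 (q : Amb 3) : fderiv ℝ hopfAmb q (frame 2 q) = hopfE3 q := by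
  rw [fderiv_hopfAmb, frame_two, hopfE3]
  ext i; fin_cases i <;> simp <;> ring

/-- The vectors `hopfAmb q`, `hopfE2 q`, `hopfE3 q` are orthogonal of length `‖q‖ ^ 2` and
positively oriented. The orientation decides the sign in the pullback of the Poisson bracket. -/
theorem cross_hopfAmb_hopfE2 (q : Amb 3) :
    cross (hopfAmb q) (hopfE2 q) = ‖q‖ ^ 2 • hopfE3 q := by
  rw [norm_sq_amb3]
  ext i
  fin_cases i
  · exact (cross_zero _ _).trans (by simp [hopfAmb, hopfE2, hopfE3]; ring)
  · exact (cross_one _ _).trans (by simp [hopfAmb, hopfE2, hopfE3]; ring)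
  · exact (cross_two _ _).trans (by simp [hopfAmb, hopfE2, hopfE3]; ring)

theorem cross_hopfAmb_hopfE3 (q : Amb 3) :
    cross (hopfAmb q) (hopfE3 q) = -(‖q‖ ^ 2 • hopfE2 q) := by
  rw [norm_sq_amb3]
  ext i
  fin_cases i
  · exact (cross_zero _ _).trans (by simp [hopfAmb, hopfE2, hopfE3]; ring)
  · exact (cross_one _ _).trans (by simp [hopfAmb, hopfE2, hopfE3]; ring)
  · exact (cross_two _ _).trans (by simp [hopfAmb, hopfE2, hopfE3]; ring)

theorem norm_pow_four_smul_eq_hopf (q : Amb 3) (v : Amb 2) :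
    (‖q‖ ^ 2) ^ 2 • v = ⟪hopfAmb q, v⟫_ℝ • hopfAmb q + ⟪hopfE2 q, v⟫_ℝ • hopfE2 q
      + ⟪hopfE3 q, v⟫_ℝ • hopfE3 q := by
  simp only [norm_sq_amb3, inner_amb2]
  ext i
  fin_cases i <;> simp [hopfAmb, hopfE2, hopfE3] <;> ring

theorem hopf_coe (p : Sph 3) : (hopf p : Amb 2) = hopfAmb p := rfl

theorem lie_hopfPullback (X : VF 3) (f : SmoothFun 2) (p : Sph 3) :
    ⁅X, hopfPullback f⁆ p = fderiv ℝ (radialExt f) (hopf p) (fderiv ℝ hopfAmb p (X.1 p)) := by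
  have h1 : HasFDerivAt (radialExt f) (fderiv ℝ (radialExt f) (hopf p)) (hopfAmb p) :=
    ((VF.smooth_fun f (coe_ne_zero (hopf p))).differentiableAt (by simp)).hasFDerivAt
  have h2 := h1.comp (p : Amb 3) (differentiable_hopfAmb p).hasFDerivAt
  rw [VF.lie_eq_of_restrict X (h := radialExt f ∘ hopfAmb)
    (fun p => (radialExt_coe f (hopf p)).symm) p h2.differentiableAt, h2.fderiv]
  rfl

/-- On `p^⊥` the map `p × ·` is an isometry carrying `∇ψ` to `X_ψ`, and both sides vanish at `a =
p`. Hence derivatives of `π^* ψ` depend on `ψ` only through `X_ψ`. -/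
theorem fderiv_radialExt_eq_inner_cross (ψ : SmoothFun 2) (p : Sph 2) (a : Amb 2) :
    fderiv ℝ (radialExt ψ) p a = ⟪cross p a, (hamField ψ).1 p⟫_ℝ := by
  have h := norm_sq_smul_eq_rot p a
  simp only [norm_eq_of_mem_sphere, one_pow, one_smul] at h
  have hs : fderiv ℝ (radialExt ψ) p p = 0 := fderiv_radialExt_self ψ
    ((VF.smooth_fun ψ (coe_ne_zero p)).differentiableAt (by simp))
  rw [inner_amb2, hamField_apply, hamField_apply, hamField_apply]
  conv_lhs => rw [h]
  simp only [map_add, map_smul, hs, smul_eq_mul]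
  ring

theorem lie_E1_hopfPullback (f : SmoothFun 2) : ⁅E1, hopfPullback f⁆ = 0 :=
  ContMDiffMap.ext fun p => by
    rw [lie_hopfPullback, E1_apply, fderiv_hopfAmb_E1, map_zero]; rfl

theorem lie_E2_hopfPullback (f : SmoothFun 2) (p : Sph 3) :
    ⁅E2, hopfPullback f⁆ p = ⟪hopfE3 p, (hamField f).1 (hopf p)⟫_ℝ := by
  rw [lie_hopfPullback, E2_apply, fderiv_hopfAmb_E2, fderiv_radialExt_eq_inner_cross, hopf_coe,
    cross_hopfAmb_hopfE2]
  simp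

theorem lie_E3_hopfPullback (f : SmoothFun 2) (p : Sph 3) :
    ⁅E3, hopfPullback f⁆ p = -⟪hopfE2 p, (hamField f).1 (hopf p)⟫_ℝ := by
  rw [lie_hopfPullback, E3_apply, fderiv_hopfAmb_E3, fderiv_radialExt_eq_inner_cross, hopf_coe,
    cross_hopfAmb_hopfE3]
  simp

/-- In the orthonormal basis `hopfE2`, `hopfE3` of the tangent plane, `X_f` has coefficients
`-E₃(π^* f)` and `E₂(π^* f)`; applying it to `h` gives the formula. -/
theorem hopfPullback_poisson (f h : SmoothFun 2) : hopfPullback (poisson f h) =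
    ⁅E2, hopfPullback f⁆ * ⁅E3, hopfPullback h⁆ - ⁅E3, hopfPullback f⁆ * ⁅E2, hopfPullback h⁆ := by
  refine ContMDiffMap.ext fun p => ?_
  have e := norm_pow_four_smul_eq_hopf p ((hamField f).1 (hopf p))
  have h0 : ⟪hopfAmb p, (hamField f).1 (hopf p)⟫_ℝ = 0 := VF.inner_coe (hamField f) (hopf p)
  rw [h0] at e
  simp only [norm_eq_of_mem_sphere, one_pow, one_smul, zero_smul, zero_add] at e
  change poisson f h (hopf p) = ⁅E2, hopfPullback f⁆ p * ⁅E3, hopfPullback h⁆ p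
    - ⁅E3, hopfPullback f⁆ p * ⁅E2, hopfPullback h⁆ p
  rw [← lie_hamField, VF.lie_fun_apply, VF.ext0_coe, e, map_add, map_smul, map_smul,
    lie_E2_hopfPullback f, lie_E3_hopfPullback f, lie_hopfPullback, lie_hopfPullback, E2_apply,
    E3_apply, fderiv_hopfAmb_E2, fderiv_hopfAmb_E3]
  simp only [smul_eq_mul]
  ring

/-! ### Descent of invariant functions to the two-sphere -/

section Descent

theorem frame_zero_frame_zero (y : Amb 3) : frame 0 (frame 0 y) = -((1 / 4 : ℝ) • y) := by
  ext i; fin_cases i <;> simp [frame_zero] <;> ring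

/-- A function with `E₁ f = 0` is constant along the Hopf circles. -/
theorem radialExt_circle_eq {f : SmoothFun 3} (hf : ⁅E1, f⁆ = 0) (q : Sph 3) (t : ℝ) :
    radialExt f (Real.cos t • (q : Amb 3) + Real.sin t • (2 : ℝ) • frame 0 q) = f q := by
  -- This is the orbit of `2 • E1` through `q`: since `2 • frame 0` squares to `-1`, its flow is
  -- given by cosine and sine.
  let γ : ℝ → Amb 3 := fun t => Real.cos t • (q : Amb 3) + Real.sin t • (2 : ℝ) • frame 0 q
  have hγ0 : ∀ t, γ t ≠ 0 := fun t ht => by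
    have h1 : ⟪γ t, γ t⟫_ℝ = 1 := by
      have e1 : ⟪(q : Amb 3), q⟫_ℝ = 1 := by simp
      have e2 : ⟪frame 0 (q : Amb 3), frame 0 q⟫_ℝ = 1 / 4 := by
        rw [inner_frame, if_pos rfl]; simp
      have e3 : ⟪frame 0 (q : Amb 3), q⟫_ℝ = 0 := inner_frame_self 0 q
      have e4 : ⟪(q : Amb 3), frame 0 q⟫_ℝ = 0 := (real_inner_comm _ _).trans e3
      simp only [γ, inner_add_left, inner_add_right, real_inner_smul_left, real_inner_smul_right,
        e1, e2, e3, e4]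
      linear_combination Real.cos_sq_add_sin_sq t
    rw [ht] at h1
    simp at h1
  have hγ : ∀ t, HasDerivAt γ ((2 : ℝ) • frame 0 (γ t)) t := fun t => by
    refine (((Real.hasDerivAt_cos t).smul_const (q : Amb 3)).add
      ((Real.hasDerivAt_sin t).smul_const ((2 : ℝ) • frame 0 (q : Amb 3)))).congr_deriv ?_
    simp only [γ, map_add, map_smul, frame_zero_frame_zero]
    module
  have hd : ∀ t, HasDerivAt (fun t => radialExt f (γ t)) 0 t := fun t => by
    have h1 := ((VF.smooth_fun f (hγ0 t)).differentiableAt (by simp)).hasFDerivAt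
    refine (h1.comp_hasDerivAt t (hγ t)).congr_deriv ?_
    have h2 : fderiv ℝ (radialExt f) (γ t) (frame 0 (γ t)) = radialExt (⁅E1, f⁆ : SmoothFun 3) (γ t) :=
      fderiv_radialExt_linear _ _ f (hγ0 t)
    rw [map_smul, h2, hf]
    simp [radialExt]
  have h := is_const_of_deriv_eq_zero (fun t => (hd t).differentiableAt) (fun t => (hd t).deriv) t 0
  refine h.trans ?_
  simp only [γ, Real.cos_zero, Real.sin_zero, one_smul, zero_smul, add_zero, radialExt_coe]

/-- Polar coordinates for `a + bi` and invariance under positive scaling extend constancy from the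
circle to the punctured complex line through `q`. -/
theorem radialExt_orbit_eq {f : SmoothFun 3} (hf : ⁅E1, f⁆ = 0) (q : Sph 3) {a b : ℝ}
    (h : a • (q : Amb 3) + b • (2 : ℝ) • frame 0 q ≠ 0) :
    radialExt f (a • (q : Amb 3) + b • (2 : ℝ) • frame 0 q) = f q := by
  set z : ℂ := ⟨a, b⟩
  have hz : z ≠ 0 := fun hz => h (by
    have ha : a = 0 := congrArg Complex.re hz
    have hb : b = 0 := congrArg Complex.im hz
    simp [ha, hb])
  have ha : a = ‖z‖ * Real.cos z.arg := (Complex.norm_mul_cos_arg z).symm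
  have hb : b = ‖z‖ * Real.sin z.arg := (Complex.norm_mul_sin_arg z).symm
  rw [ha, hb, mul_smul, mul_smul _ (Real.sin _), ← smul_add, radialExt_smul _ (norm_pos_iff.2 hz),
    radialExt_circle_eq hf]

/-- A section of the cone over the Hopf map, vanishing only over the ray through `(-1, 0, 0)`. -/
def hopfSection₁ (y : Amb 2) : Amb 3 := !₂[1 + y 0, y 1, y 2, 0]

/-- A section of the cone over the Hopf map, vanishing only over the ray through `(1, 0, 0)`. -/
def hopfSection₂ (y : Amb 2) : Amb 3 := !₂[y 2, 0, 1 - y 0, -y 1]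

theorem contDiff_hopfSection₁ : ContDiff ℝ ∞ hopfSection₁ := by
  rw [contDiff_euclidean]
  intro i
  fin_cases i <;> simp [hopfSection₁] <;> fun_prop

theorem contDiff_hopfSection₂ : ContDiff ℝ ∞ hopfSection₂ := by
  rw [contDiff_euclidean]
  intro i
  fin_cases i <;> simp [hopfSection₂] <;> fun_prop

theorem sum_sq_sph3 (q : Sph 3) : (q : Amb 3) 0 ^ 2 + (q : Amb 3) 1 ^ 2 + (q : Amb 3) 2 ^ 2
    + (q : Amb 3) 3 ^ 2 = 1 := by
  rw [← norm_sq_amb3]; simp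

theorem sum_sq_sph2 (p : Sph 2) : (p : Amb 2) 0 ^ 2 + (p : Amb 2) 1 ^ 2 + (p : Amb 2) 2 ^ 2 = 1 := by
  rw [← norm_sq_amb2]; simp

/-- The section over `hopf q` lies in the complex line through `q`, for the complex structure `2 •
frame 0`; so invariant functions take the same value there as at `q`. -/
theorem hopfSection₁_hopf (q : Sph 3) : hopfSection₁ (hopf q) =
    (2 * (q : Amb 3) 0) • (q : Amb 3) + (2 * (q : Amb 3) 3) • (2 : ℝ) • frame 0 q := by
  have h := sum_sq_sph3 q
  rw [hopf_coe]
  ext i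
  fin_cases i <;> simp [hopfSection₁, hopfAmb, frame_zero]
  · linear_combination -h
  all_goals ring

theorem hopfSection₂_hopf (q : Sph 3) : hopfSection₂ (hopf q) =
    (2 * (q : Amb 3) 2) • (q : Amb 3) + (2 * (q : Amb 3) 1) • (2 : ℝ) • frame 0 q := by
  have h := sum_sq_sph3 q
  rw [hopf_coe]
  ext i
  fin_cases i <;> simp [hopfSection₂, hopfAmb, frame_zero]
  · ring
  · ring
  · linear_combination -h
  · ring

theorem hopfAmb_hopfSection₁ (p : Sph 2) :
    hopfAmb (hopfSection₁ p) = ‖hopfSection₁ p‖ ^ 2 • (p : Amb 2) := by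
  have h := sum_sq_sph2 p
  rw [norm_sq_amb3]
  ext i
  fin_cases i <;> simp [hopfSection₁, hopfAmb]
  · linear_combination (-1 - (p : Amb 2) 0) * h
  · linear_combination (-(p : Amb 2) 1) * h
  · linear_combination (-(p : Amb 2) 2) * h

theorem hopfAmb_hopfSection₂ (p : Sph 2) :
    hopfAmb (hopfSection₂ p) = ‖hopfSection₂ p‖ ^ 2 • (p : Amb 2) := by
  have h := sum_sq_sph2 p
  rw [norm_sq_amb3]
  ext i
  fin_cases i <;> simp [hopfSection₂, hopfAmb]
  · linear_combination (1 - (p : Amb 2) 0) * h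
  · linear_combination (-(p : Amb 2) 1) * h
  · linear_combination (-(p : Amb 2) 2) * h

theorem hopfSection_ne_zero (y : Amb 2) : hopfSection₁ y ≠ 0 ∨ hopfSection₂ y ≠ 0 := by
  by_contra! h
  have h1 := congrArg (fun v : Amb 3 => v 0) h.1
  have h2 := congrArg (fun v : Amb 3 => v 2) h.2
  simp [hopfSection₁, hopfSection₂] at h1 h2
  linarith

theorem exists_hopf_eq {p : Sph 2} {s : Amb 3} (hs : s ≠ 0)
    (h : hopfAmb s = ‖s‖ ^ 2 • (p : Amb 2)) : ∃ q, hopf q = p := by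
  obtain ⟨q, hq, -⟩ := exists_radial ℝ hs
  have hn : ‖s‖ ≠ 0 := by simpa using hs
  refine ⟨q, Subtype.ext ?_⟩
  have e : hopfAmb (‖s‖⁻¹ • s) = (‖s‖⁻¹ ^ 2) • hopfAmb s := by
    ext i
    fin_cases i <;> simp [hopfAmb] <;> ring
  rw [hopf_coe, hq, e, h, smul_smul, ← mul_pow, inv_mul_cancel₀ hn, one_pow, one_smul]

theorem hopf_surjective : Function.Surjective hopf := fun p =>
  (hopfSection_ne_zero p).elim (fun h => exists_hopf_eq h (hopfAmb_hopfSection₁ p))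
    fun h => exists_hopf_eq h (hopfAmb_hopfSection₂ p)

theorem hopfPullback_injective : Function.Injective hopfPullback := fun f h e =>
  ContMDiffMap.ext fun p => by
    obtain ⟨q, rfl⟩ := hopf_surjective p
    exact DFunLike.congr_fun e q

/-- The descended function takes the value of `f` at an arbitrary preimage. Where a section `s` does
not vanish it coincides with `radialExt f ∘ s`, which is smooth, and the two sections have no common
zero. -/
theorem exists_hopfPullback_eq {f : SmoothFun 3} (hf : ⁅E1, f⁆ = 0) :
    ∃ g : SmoothFun 2, hopfPullback g = f := by
  have h1 : ∀ q : Sph 3, hopfSection₁ (hopf q) ≠ 0 → radialExt f (hopfSection₁ (hopf q)) = f q :=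
    fun q hq => by
      rw [hopfSection₁_hopf] at hq ⊢
      exact radialExt_orbit_eq hf q hq
  have h2 : ∀ q : Sph 3, hopfSection₂ (hopf q) ≠ 0 → radialExt f (hopfSection₂ (hopf q)) = f q :=
    fun q hq => by
      rw [hopfSection₂_hopf] at hq ⊢
      exact radialExt_orbit_eq hf q hq
  have hs : ∀ p, hopf (Function.surjInv hopf_surjective p) = p :=
    Function.surjInv_eq hopf_surjective
  have := Fact.mk (@finrank_euclideanSpace_fin ℝ _ (2 + 1))
  have key : ∀ s : Amb 2 → Amb 3, ContDiff ℝ ∞ s →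
      (∀ q : Sph 3, s (hopf q) ≠ 0 → radialExt f (s (hopf q)) = f q) → ∀ p : Sph 2, s p ≠ 0 →
      ContMDiffAt (𝓡 2) 𝓘(ℝ, ℝ) ∞ (fun p => f (Function.surjInv hopf_surjective p)) p := by
    intro s hsm hsf p hp
    have h3 : ContDiffAt ℝ ∞ (fun y => radialExt f (s y)) p :=
      ContDiffAt.comp (p : Amb 2) (VF.smooth_fun f hp) hsm.contDiffAt
    have h4 : ContMDiffAt (𝓡 2) 𝓘(ℝ, ℝ) ∞ (fun p : Sph 2 => radialExt f (s p)) p :=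
      ContMDiffAt.comp p h3.contMDiffAt (contMDiff_coe_sphere p)
    refine h4.congr_of_eventuallyEq ?_
    have hc : Continuous fun p : Sph 2 => s p := hsm.continuous.comp continuous_subtype_val
    filter_upwards [(isOpen_ne.preimage hc).mem_nhds hp] with p' hp'
    have := hsf (Function.surjInv hopf_surjective p')
    rw [hs] at this
    exact (this hp').symm
  refine ⟨⟨fun p => f (Function.surjInv hopf_surjective p), fun p => ?_⟩,
    ContMDiffMap.ext fun q => ?_⟩
  · exact (hopfSection_ne_zero p).elim (key _ contDiff_hopfSection₁ h1 p)
      (key _ contDiff_hopfSection₂ h2 p)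
  · change f (Function.surjInv hopf_surjective (hopf q)) = f q
    set q' := Function.surjInv hopf_surjective (hopf q) with hq'
    have e : hopf q' = hopf q := hs _
    rcases hopfSection_ne_zero (hopf q) with h | h
    · rw [← h1 q h, ← h1 q' (by rwa [e]), e]
    · rw [← h2 q h, ← h2 q' (by rwa [e]), e]

end Descent

/-! ### Poisson identities pulled back to the three-sphere -/

section Poisson

variable (f g h ψ χ : SmoothFun 2)

theorem hopfPullback_add : hopfPullback (f + g) = hopfPullback f + hopfPullback g := rfl

theorem hopfPullback_smul (c : ℝ) : hopfPullback (c • f) = c • hopfPullback f := rfl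

theorem hopfPullback_neg : hopfPullback (-f) = -hopfPullback f := rfl

theorem hopfPullback_sub : hopfPullback (f - g) = hopfPullback f - hopfPullback g := rfl

theorem poisson_skew : poisson f g = -poisson g f := by
  apply hopfPullback_injective
  change _ = -hopfPullback (poisson g f)
  rw [hopfPullback_poisson, hopfPullback_poisson]
  ring

/-- On pullbacks `[E2,E3] = -E1` acts as zero, so `E2` and `E3` commute there and the identity is
the one for canonical coordinates. -/
theorem poisson_jacobi :
    poisson f (poisson g h) = poisson (poisson f g) h + poisson g (poisson f h) := by
  apply hopfPullback_injective
  rw [hopfPullback_add]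
  simp only [hopfPullback_poisson, lie_sub, VF.lie_mul, lie_E3_lie_E2, lie_E1_hopfPullback,
    add_zero]
  ring

theorem lie_hamField_hamField : ⁅hamField f, hamField g⁆ = hamField (poisson f g) := by
  refine VF.ext_of_lie fun σ => ?_
  rw [lie_lie]
  simp only [lie_hamField]
  rw [poisson_jacobi]
  abel

/-- Expresses the ambiguity of the stream function through the two derivatives that occur in the
normal form upstairs, so its kernel need not be determined. -/
theorem hamField_eq_iff : hamField ψ = hamField χ ↔
    ⁅E2, hopfPullback ψ⁆ = ⁅E2, hopfPullback χ⁆ ∧ ⁅E3, hopfPullback ψ⁆ = ⁅E3, hopfPullback χ⁆ := by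
  constructor
  · intro h
    exact ⟨ContMDiffMap.ext fun p => by rw [lie_E2_hopfPullback, lie_E2_hopfPullback, h],
      ContMDiffMap.ext fun p => by rw [lie_E3_hopfPullback, lie_E3_hopfPullback, h]⟩
  · rintro ⟨h2, h3⟩
    refine VF.ext_of_lie fun σ => ?_
    rw [lie_hamField, lie_hamField]
    apply hopfPullback_injective
    rw [hopfPullback_poisson, hopfPullback_poisson, h2, h3]

end Poisson

/-! ### The cocycle and the Abelian extension -/

/-- The linear map `ψ ↦ X_ψ` onto the divergence-free vector fields on `S²`. -/
def hamLinear : SmoothFun 2 →ₗ[ℝ] divFree 2 where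
  toFun ψ := ⟨hamField ψ, hamField_mem_divFree ψ⟩
  map_add' ψ χ := Subtype.ext <| VF.ext_of_lie fun σ => by
    change ⁅hamField (ψ + χ), σ⁆ = ⁅hamField ψ + hamField χ, σ⁆
    rw [add_lie, lie_hamField, lie_hamField, lie_hamField, poisson_skew, ← lie_hamField, lie_add,
      lie_hamField, lie_hamField, poisson_skew ψ, poisson_skew χ]
    abel
  map_smul' c ψ := Subtype.ext <| VF.ext_of_lie fun σ => by
    change ⁅hamField (c • ψ), σ⁆ = ⁅c • hamField ψ, σ⁆
    rw [smul_lie, lie_hamField, lie_hamField, poisson_skew, ← lie_hamField, lie_smul,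
      lie_hamField, poisson_skew ψ, smul_neg]

/-- A constant may be added to a stream function, so a linear choice must be made; it exists because
a surjection of real vector spaces splits. -/
theorem exists_stream : ∃ s : divFree 2 →ₗ[ℝ] SmoothFun 2, hamLinear ∘ₗ s = LinearMap.id :=
  hamLinear.exists_rightInverse_of_surjective <| LinearMap.range_eq_top.2 fun v => by
    obtain ⟨ψ, hψ⟩ := exists_eq_hamField v.2
    exact ⟨ψ, Subtype.ext hψ.symm⟩

/-- A linear choice of stream functions for divergence-free vector fields on `S²`. -/
def stream : divFree 2 →ₗ[ℝ] SmoothFun 2 := exists_stream.choose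

theorem hamField_stream (v : divFree 2) : hamField (stream v) = v :=
  congrArg Subtype.val (LinearMap.congr_fun exists_stream.choose_spec v)

theorem divFree_lie_eq {v : divFree 2} {ψ : SmoothFun 2} (hv : (v : VF 2) = hamField ψ)
    (σ : SmoothFun 2) : ⁅v, σ⁆ = poisson ψ σ := by
  rw [← lie_hamField, ← hv]; rfl

theorem divFree_lie (v : divFree 2) (σ : SmoothFun 2) : ⁅v, σ⁆ = poisson (stream v) σ :=
  divFree_lie_eq (hamField_stream v).symm σ

theorem poisson_congr {ψ χ : SmoothFun 2} (h : hamField ψ = hamField χ) (σ : SmoothFun 2) :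
    poisson ψ σ = poisson χ σ := by
  rw [← lie_hamField, h, lie_hamField]

/-- The chosen stream function of `⁅v, w⁆` may differ from `{stream v, stream w}`, but both have the
same Hamiltonian field, and the Poisson bracket sees nothing else. -/
theorem poisson_stream_lie (v w : divFree 2) (σ : SmoothFun 2) :
    poisson (stream ⁅v, w⁆) σ = poisson (poisson (stream v) (stream w)) σ := by
  refine poisson_congr ?_ σ
  rw [hamField_stream, ← lie_hamField_hamField, hamField_stream, hamField_stream]
  rfl

theorem poisson_self (f : SmoothFun 2) : poisson f f = 0 := by
  apply hopfPullback_injective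
  rw [hopfPullback_poisson, mul_comm, sub_self]; rfl

theorem poisson_neg (f g : SmoothFun 2) : poisson f (-g) = -poisson f g := by
  rw [← lie_hamField, lie_neg, lie_hamField]

/-- The cocycle `b(X_ψ, X_χ) = -{ψ, χ}` on `𝔛_μ(S²)` with values in `C^∞(S²)`. -/
def hopfCocycle : LieModule.Cohomology.twoCocycle ℝ (divFree 2) (SmoothFun 2) :=
  ⟨⟨LinearMap.mk₂ ℝ (fun v w => -⁅v, stream w⁆)
      (fun v v' w => by rw [add_lie]; abel) (fun c v w => by rw [smul_lie, smul_neg])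
      (fun v w w' => by rw [map_add, lie_add]; abel)
      (fun c v w => by rw [map_smul, lie_smul, smul_neg]),
    fun v => by
      change -⁅v, stream v⁆ = 0
      rw [divFree_lie, poisson_self, neg_zero]⟩, by
    rw [LieModule.Cohomology.mem_twoCocycle_iff]
    ext1 u; ext1 v; ext1 w
    change ⁅u, -⁅v, stream w⁆⁆ - ⁅v, -⁅u, stream w⁆⁆ + ⁅w, -⁅u, stream v⁆⁆ - -⁅⁅u, v⁆, stream w⁆
      + -⁅⁅u, w⁆, stream v⁆ - -⁅⁅v, w⁆, stream u⁆ = 0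
    -- In terms of stream functions every summand is a double Poisson bracket, and the cocycle
    -- condition becomes the Jacobi identity.
    simp only [divFree_lie, poisson_neg, poisson_stream_lie]
    generalize stream u = f
    generalize stream v = g
    generalize stream w = h
    rw [poisson_skew (poisson f h) g, poisson_skew (poisson g h) f, poisson_skew (poisson f g) h]
    rw [poisson_jacobi f g h, poisson_skew (poisson f g) h]
    abel⟩

theorem hopfCocycle_apply {v w : divFree 2} {ψ χ : SmoothFun 2} (hv : (v : VF 2) = hamField ψ)
    (hw : (w : VF 2) = hamField χ) : hopfCocycle.1.1 v w = -poisson ψ χ := by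
  change -⁅v, stream w⁆ = _
  rw [divFree_lie_eq hv, poisson_skew,
    poisson_congr (ψ := stream w) (χ := χ) (by rw [hamField_stream, hw]), ← poisson_skew]

/-- The field `σ E₁ - (E₃ ψ) E₂ + (E₂ ψ) E₃`. -/
def formField (σ ψ : SmoothFun 3) : VF 3 := frameField σ (-⁅E3, ψ⁆) ⁅E2, ψ⁆

theorem formField_lie (σ ψ f : SmoothFun 3) : ⁅formField σ ψ, f⁆ =
    σ * ⁅E1, f⁆ + (⁅E2, ψ⁆ * ⁅E3, f⁆ - ⁅E3, ψ⁆ * ⁅E2, f⁆) := by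
  rw [formField, frameField_lie]; ring

/-- The summand `-{ψ₁,ψ₂}` in the first slot is produced by `[E2,E3] = -E1`, and it is the origin of
the cocycle. Invariance of the potentials removes their `E1` derivatives. -/
theorem lie_formField {σ₁ σ₂ ψ₁ ψ₂ : SmoothFun 3} (h₁ : ⁅E1, ψ₁⁆ = 0) (h₂ : ⁅E1, ψ₂⁆ = 0) :
    ⁅formField σ₁ ψ₁, formField σ₂ ψ₂⁆ = formField
      (⁅formField σ₁ ψ₁, σ₂⁆ - ⁅formField σ₂ ψ₂, σ₁⁆
        - (⁅E2, ψ₁⁆ * ⁅E3, ψ₂⁆ - ⁅E3, ψ₁⁆ * ⁅E2, ψ₂⁆))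
      (⁅E2, ψ₁⁆ * ⁅E3, ψ₂⁆ - ⁅E3, ψ₁⁆ * ⁅E2, ψ₂⁆) := by
  refine VF.ext_of_lie fun f => ?_
  rw [lie_lie]
  simp only [formField_lie, lie_sub, lie_add, VF.lie_mul, lie_E1_lie_E2, lie_E1_lie_E3,
    lie_E3_lie_E2, h₁, h₂, lie_zero]
  ring

/-- The isomorphism from the extension to `𝔛¹_μ(S³)`, `(X_ψ, σ) ↦ formField (π^* σ) (π^* ψ)`. -/
def hopfLift : LieAlgebra.ofTwoCocycle hopfCocycle →ₗ⁅ℝ⁆ hopfDivFree where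
  toFun x := ⟨formField (hopfPullback x.carrier.2) (hopfPullback (stream x.carrier.1)),
    (mem_hopfDivFree_iff _).2 ⟨_, _, lie_E1_hopfPullback _, lie_E1_hopfPullback _,
      hasForm_iff.2 rfl⟩⟩
  map_add' x y := Subtype.ext <| VF.ext_of_lie fun f => by
    change ⁅formField (hopfPullback (x.carrier.2 + y.carrier.2))
      (hopfPullback (stream (x.carrier.1 + y.carrier.1))), f⁆ = ⁅formField _ _ + formField _ _, f⁆
    rw [add_lie, map_add, hopfPullback_add, hopfPullback_add]
    simp only [formField_lie, lie_add]
    ring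
  map_smul' c x := Subtype.ext <| VF.ext_of_lie fun f => by
    change ⁅formField (hopfPullback (c • x.carrier.2))
      (hopfPullback (stream (c • x.carrier.1))), f⁆ = ⁅c • formField _ _, f⁆
    rw [smul_lie, map_smul, hopfPullback_smul, hopfPullback_smul]
    simp only [formField_lie, lie_smul, smul_mul_assoc, smul_add, smul_sub]
  map_lie' {x y} := Subtype.ext <| by
    change formField
      (hopfPullback (-⁅x.carrier.1, stream y.carrier.1⁆ + ⁅x.carrier.1, y.carrier.2⁆
        - ⁅y.carrier.1, x.carrier.2⁆)) (hopfPullback (stream ⁅x.carrier.1, y.carrier.1⁆)) =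
      ⁅formField _ _, formField _ _⁆
    -- The stream function of the bracket enters only through its `E2` and `E3` derivatives, so it
    -- may be replaced by the Poisson bracket of the stream functions.
    have h := (hamField_eq_iff (stream ⁅x.carrier.1, y.carrier.1⁆)
      (poisson (stream x.carrier.1) (stream y.carrier.1))).1 (by
        rw [hamField_stream, ← lie_hamField_hamField, hamField_stream, hamField_stream]; rfl)
    rw [lie_formField (lie_E1_hopfPullback _) (lie_E1_hopfPullback _), ← hopfPullback_poisson,
      formField, h.1, h.2]
    simp only [formField_lie, lie_E1_hopfPullback, ← hopfPullback_poisson, divFree_lie]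
    refine congrArg (frameField · _ _) ?_
    rw [hopfPullback_sub, hopfPullback_add, hopfPullback_neg]
    ring

/-- Frame coefficients are unique: the first recovers `σ` because `π^*` is injective, and the other
two recover `X_ψ`. This one equivalence yields injectivity of `hopfLift` and the stated
correspondence. -/
theorem hopfLift_eq_iff (x : LieAlgebra.ofTwoCocycle hopfCocycle) {v : divFree 2}
    {σ ψ : SmoothFun 2} (hv : (v : VF 2) = hamField ψ) :
    x = LieAlgebra.ofProd hopfCocycle (v, σ) ↔
      HasForm (hopfLift x : VF 3) (hopfPullback σ) (hopfPullback ψ) := by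
  have e : (hopfLift x : VF 3) = frameField (hopfPullback x.carrier.2)
    (-⁅E3, hopfPullback (stream x.carrier.1)⁆) ⁅E2, hopfPullback (stream x.carrier.1)⁆ := rfl
  rw [hasForm_iff, e, frameField_inj, neg_inj, and_comm (a := (⁅E3, _⁆ : SmoothFun 3) = _),
    ← hamField_eq_iff, hamField_stream, ← hv, hopfPullback_injective.eq_iff]
  constructor
  · rintro rfl
    exact ⟨rfl, rfl⟩
  · rintro ⟨h1, h2⟩
    obtain ⟨⟨w, τ⟩⟩ := x
    obtain rfl : τ = σ := h1
    obtain rfl : w = v := Subtype.ext h2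
    rfl

theorem hopfLift_bijective : Function.Bijective hopfLift := by
  constructor
  · intro x y h
    have hy := (hopfLift_eq_iff y (v := y.carrier.1) (σ := y.carrier.2)
      (hamField_stream y.carrier.1).symm).1 rfl
    rw [← h] at hy
    exact (hopfLift_eq_iff x (hamField_stream y.carrier.1).symm).2 hy
  · intro u
    obtain ⟨σ', ψ', hσ, hψ, hu⟩ := (mem_hopfDivFree_iff _).1 u.2
    obtain ⟨σ, rfl⟩ := exists_hopfPullback_eq hσ
    obtain ⟨ψ, rfl⟩ := exists_hopfPullback_eq hψ
    refine ⟨LieAlgebra.ofProd hopfCocycle (hamLinear ψ, σ), Subtype.ext ?_⟩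
    have h := (hopfLift_eq_iff (LieAlgebra.ofProd hopfCocycle (hamLinear ψ, σ))
      (v := hamLinear ψ) (ψ := ψ) (σ := σ) rfl).1 rfl
    exact (hasForm_iff.1 h).trans (hasForm_iff.1 hu).symm

end SphereFlow

end

open SphereFlow
theorem mainTheorem4 :
    -- `𝔛_μ(S²)` consists of the fields `X_ψ`, and it acts on `C^∞(S²)` by `ρ(X_ψ) σ = {ψ, σ}`
    (∀ v : VF 2, v ∈ divFree 2 ↔ ∃ ψ : SmoothFun 2, v = hamField ψ) ∧
    (∀ (v : divFree 2) (ψ σ : SmoothFun 2), (v : VF 2) = hamField ψ → ⁅v, σ⁆ = poisson ψ σ) ∧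
    -- the `E₁`-invariant functions on `S³` are the pullbacks of functions on `S²`
    (∀ f' : SmoothFun 3, ⁅E1, f'⁆ = 0 ↔ ∃ f : SmoothFun 2, hopfPullback f = f') ∧
    Function.Injective hopfPullback ∧
    -- every `u ∈ 𝔛¹_μ(S³)` is given by two `E₁`-invariant functions
    (∀ u : VF 3, u ∈ hopfDivFree ↔
      ∃ σ' ψ' : SmoothFun 3, ⁅E1, σ'⁆ = 0 ∧ ⁅E1, ψ'⁆ = 0 ∧ HasForm u σ' ψ') ∧
    -- `b(X_ψ₁, X_ψ₂) = -{ψ₁, ψ₂}` is a 2-cocycle `b`, and the Abelian extension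
    -- of `𝔛_μ(S²)` by `C^∞(S²)` that it defines is isomorphic to `𝔛¹_μ(S³)`
    ∃ b : LieModule.Cohomology.twoCocycle ℝ (divFree 2) (SmoothFun 2),
      (∀ (v₁ v₂ : divFree 2) (ψ₁ ψ₂ : SmoothFun 2),
        (v₁ : VF 2) = hamField ψ₁ → (v₂ : VF 2) = hamField ψ₂ →
          b.1.1 v₁ v₂ = -poisson ψ₁ ψ₂) ∧
      ∃ Φ : hopfDivFree ≃ₗ⁅ℝ⁆ LieAlgebra.ofTwoCocycle b,
        ∀ (u : hopfDivFree) (v : divFree 2) (σ ψ : SmoothFun 2), (v : VF 2) = hamField ψ →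
          (Φ u = LieAlgebra.ofProd b (v, σ) ↔
            HasForm u (hopfPullback σ) (hopfPullback ψ)) := by
  refine ⟨fun v => ⟨exists_eq_hamField, ?_⟩, fun v ψ σ hv => divFree_lie_eq hv σ,
    fun f' => ⟨exists_hopfPullback_eq, ?_⟩, hopfPullback_injective, mem_hopfDivFree_iff,
    hopfCocycle, fun v₁ v₂ ψ₁ ψ₂ h₁ h₂ => hopfCocycle_apply h₁ h₂,
    (LieEquiv.ofBijective hopfLift hopfLift_bijective).symm, fun u v σ ψ hv => ?_⟩
  · rintro ⟨ψ, rfl⟩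
    exact hamField_mem_divFree ψ
  · rintro ⟨f, rfl⟩
    exact lie_E1_hopfPullback f
  · have h := hopfLift_eq_iff ((LieEquiv.ofBijective hopfLift hopfLift_bijective).symm u)
      (σ := σ) hv
    have e : hopfLift ((LieEquiv.ofBijective hopfLift hopfLift_bijective).symm u) = u :=
      (LieEquiv.ofBijective hopfLift hopfLift_bijective).apply_symm_apply u
    rwa [e] at h
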